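/- Let $R=(|R|,\le,+,\cdot,0,1)$ be a resource semiring: a semiring with a partial order for which $+$ and $\cdot$ are monotone. **Doctrines.** A doctrine is a functor $P:\mathcal C^{op}\to\mathbf{Pos}$, where $\mathcal C$ (the base) has chosen finite products; write $P_f$ for $P(f)$. A 1-arrow $(F,f):P\to Q$ is a finite-product preserving functor $F$ between the bases with a natural transformation $f:P\to Q\circ F^{op}$; a 2-arrow $(F,f)\Rightarrow(G,g)$ is a natural transformation $\theta:F\Rightarrow G$ with $f_X(\alpha)\le Q_{\theta_X}(g_X(\alpha))$ for all $X$ and $\alpha\in P(X)$. A primary linear doctrine is a doctrine each of whose fibres is an ordered commutative monoid $(P(X),\ast,\kappa_X)$, preserved by all $P_f$. An $R$-graded doctrine is a primary linear doctrine $P$ with natural transformations $\lceil r\rceil:P\to P$ of posets ($r\in|R|$) such that $\kappa\le\lceil r\rceil\kappa$, $\ \lceil r\rceil\alpha\ast\lceil r\rceil\beta\le\lceil r\rceil(\alpha\ast\beta)$, $\ \lceil 0\rceil\alpha\le\kappa$, $\ \lceil r+s\rceil\alpha\le\lceil r\rceil\alpha\ast\lceil s\rceil\alpha$, $\ \lceil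 1\rceil\alpha\le\alpha$, $\ \lceil r\cdot s\rceil\alpha\le\lceil r\rceil\lceil s\rceil\alpha$, and $\lceil r\rceil\alpha\le\lceil s\rceil\alpha$ whenever $s\le r$. A 1-arrow of $R$-graded doctrines is a 1-arrow of doctrines preserving $\ast$, $\kappa$ and all $\lceil r\rceil$; 2-arrows are those of doctrines. An element $\alpha$ of a fibre is *intuitionistic* if $\alpha\le\lceil r\rceil\alpha$ for all $r$. **Lipschitz doctrines.** A distance on $A$ is $\rho\in P(A\times A)$ with $\kappa_A\le P_{\Delta_A}(\rho)$, $\rho\le P_{\langle\pi_2,\pi_1\rangle}(\rho)$ and $P_{\langle\pi_1,\pi_2\rangle}(\rho)\ast P_{\langle\pi_2,\pi_3\rangle}(\rho)\le P_{\langle\pi_1,\pi_3\rangle}(\rho)$. An $R$-Lipschitz doctrine is an $R$-graded doctrine with a distance $\delta_A$ on each object $A$ such that, for all $A,X$: for each $\alpha\in P(X\times A)$ there is $r\in|R|$ with $P_{\langle\pi_1,\pi_2\rangle}(\alpha)\ast\lceil r\rceil P_{\langle\pi_2,\pi_3\rangle}(\delta_A)\le P_{\langle\pi_1,\pi_3\rangle}(\alpha)$;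 $\ \delta_{A\times X}=P_{\langle\pi_1,\pi_3\rangle}(\delta_A)\ast P_{\langle\pi_2,\pi_4\rangle}(\delta_X)$; $\ \delta_{A\times X}\le P_{\langle\pi_1,\pi_3\rangle}(\delta_A)$ and $\delta_{A\times X}\le P_{\langle\pi_2,\pi_4\rangle}(\delta_X)$; $\ \delta_1=\kappa$. These are the objects of a 2-category $\mathbf{Lip}_R$, whose 1-arrows are the 1-arrows $(F,f)$ of $R$-graded doctrines with $f_{A\times A}(\delta_A)=\delta_{FA}$ (up to the canonical isomorphism $F(A\times A)\cong FA\times FA$) and whose 2-arrows are all 2-arrows of doctrines. **Elementary doctrines.** An $R$-graded doctrine is elementary if for each $A$ there is $\delta_A\in P(A\times A)$ with $\kappa_A\le P_{\Delta_A}(\delta_A)$ and $P_{\langle\pi_1,\pi_2\rangle}(\alpha)\ast P_{\langle\pi_2,\pi_3\rangle}(\delta_A)\le P_{\langle\pi_1,\pi_3\rangle}(\alpha)$ for all $X$ and $\alpha\in P(X\times A)$. Such $\delta_A$ is unique, and $E_{\mathrm{id}_X\times\Delta_A}(\alpha)=P_{\langle\pi_1,\pi_2\rangle}(\alpha)\ast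 P_{\langle\pi_2,\pi_3\rangle}(\delta_A)$ is left adjoint to $P_{\mathrm{id}_X\times\Delta_A}$. These are the objects of a 2-category $\mathbf{El}_R$, whose 1-arrows are the 1-arrows $(F,f)$ of $R$-graded doctrines with $E_{\mathrm{id}_{FX}\times\Delta_{FA}}\circ f_{X\times A}=f_{X\times A\times A}\circ E_{\mathrm{id}_X\times\Delta_A}$ for all $X,A$ (up to the canonical isomorphisms), and whose 2-arrows are all 2-arrows of doctrines. **The 2-functors.** An elementary $R$-graded doctrine is $R$-Lipschitz with distances the $\delta_A$; this gives the inclusion 2-functor $EL:\mathbf{El}_R\to\mathbf{Lip}_R$. The 2-functor $LE:\mathbf{Lip}_R\to\mathbf{El}_R$ sends an $R$-Lipschitz doctrine $P$ to its restriction to the full subcategory of the base on the objects $A$ with $\delta_A$ intuitionistic (which is closed under the chosen finite products, and on which $\delta$ gives the equality predicates), and restricts 1-arrows and 2-arrows accordingly. **Theorem.** The 2-functor $EL$ is 2-comonadic: 1. $LE$ is right 2-adjoint to $EL$, with counit at $P$ the inclusion of the restriction of $P$ into $P$ (the inclusion functor on the bases, identities on the fibres); 2. the comparison 2-functor from $\mathbf{El}_R$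 to the 2-category of (strict) coalgebras of the induced 2-comonad $EL\circ LE$ is an isomorphism of 2-categories, and this 2-comonad is KZ: the structure 1-arrow $c$ of each coalgebra is left adjoint to the counit $\varepsilon$, with the identity $1=\varepsilon\circ c$ as unit of the adjunction. -/

import Mathlib

universe w v u w₁ v₁ u₁ w₂ v₂ u₂ x

namespace TwoCat

open CategoryTheory Bicategory

/-- A strict 2-natural transformation between 2-functors of strict 2-categories. -/
structure TwoNatTrans {B : Type u₁} [Bicategory.{w₁, v₁} B] {C : Type u₂} [Bicategory.{w₂, v₂} C]
    (F G : StrictPseudofunctor B C) where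
  app (X : B) : F.obj X ⟶ G.obj X
  naturality {X Y : B} (f : X ⟶ Y) : F.map f ≫ app Y = app X ≫ G.map f
  naturality₂ {X Y : B} {f g : X ⟶ Y} (η : f ⟶ g) :
    F.map₂ η ▷ app Y ≫ eqToHom (naturality g) = eqToHom (naturality f) ≫ app X ◁ G.map₂ η

/-- A 2-adjunction `F ⊣ G`, with 2-natural unit and counit and strict triangle identities. -/
structure TwoAdjunction {B : Type u₁} [Bicategory.{w₁, v₁} B] {C : Type u₂}
    [Bicategory.{w₂, v₂} C] (F : StrictPseudofunctor B C) (G : StrictPseudofunctor C B) where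
  unit : TwoNatTrans (StrictPseudofunctor.id B) (F.comp G)
  counit : TwoNatTrans (G.comp F) (StrictPseudofunctor.id C)
  left_triangle (X : B) :
    F.map (unit.app X) ≫ counit.app (F.obj X) = 𝟙 (F.obj X)
  right_triangle (Y : C) :
    unit.app (G.obj Y) ≫ G.map (counit.app Y) = 𝟙 (G.obj Y)

/-- A (strict) 2-comonad on a strict 2-category. -/
structure TwoComonad (C : Type u) [Bicategory.{w, v} C] where
  fn : StrictPseudofunctor C C
  counit : TwoNatTrans fn (StrictPseudofunctor.id C)
  comult : TwoNatTrans fn (fn.comp fn)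
  comult_counit (X : C) :
    (comult.app X : fn.obj X ⟶ fn.obj (fn.obj X)) ≫
      (counit.app (fn.obj X) : fn.obj (fn.obj X) ⟶ fn.obj X) = 𝟙 (fn.obj X)
  comult_map_counit (X : C) :
    (comult.app X : fn.obj X ⟶ fn.obj (fn.obj X)) ≫
      fn.map (counit.app X : fn.obj X ⟶ X) = 𝟙 (fn.obj X)
  coassoc (X : C) :
    (comult.app X : fn.obj X ⟶ fn.obj (fn.obj X)) ≫
        fn.map (comult.app X : fn.obj X ⟶ fn.obj (fn.obj X)) =
      (comult.app X : fn.obj X ⟶ fn.obj (fn.obj X)) ≫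
        (comult.app (fn.obj X) : fn.obj (fn.obj X) ⟶ fn.obj (fn.obj (fn.obj X)))

section Adj

variable {B : Type u₁} [Bicategory.{w₁, v₁} B] {C : Type u₂} [Bicategory.{w₂, v₂} C]
    {F : StrictPseudofunctor B C} {G : StrictPseudofunctor C B}

theorem map₂_whiskerRight' (F : StrictPseudofunctor B C) {X Y Z : B} {f g : X ⟶ Y} (η : f ⟶ g)
    (h : Y ⟶ Z) : F.map₂ (η ▷ h) = eqToHom (F.map_comp f h) ≫ F.map₂ η ▷ F.map h ≫
      eqToHom (F.map_comp g h).symm := by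
  simp [F.map₂_whisker_right, F.mapComp_eq_eqToIso]

theorem map₂_whiskerLeft' (F : StrictPseudofunctor B C) {X Y Z : B} (h : X ⟶ Y) {f g : Y ⟶ Z}
    (η : f ⟶ g) : F.map₂ (h ◁ η) = eqToHom (F.map_comp h f) ≫ F.map h ◁ F.map₂ η ≫
      eqToHom (F.map_comp h g).symm := by
  simp [F.map₂_whisker_left, F.mapComp_eq_eqToIso]

theorem map₂_square (F : StrictPseudofunctor B C) {X X' Y Y' : B} {a b : X ⟶ Y} {u : X ⟶ X'}
    {v : Y ⟶ Y'} {a' b' : X' ⟶ Y'} {η : a ⟶ b} {η' : a' ⟶ b'} (ha : a ≫ v = u ≫ a')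
    (hb : b ≫ v = u ≫ b') (h : η ▷ v ≫ eqToHom hb = eqToHom ha ≫ u ◁ η') :
    F.map₂ η ▷ F.map v ≫ eqToHom ((F.map_comp b v).symm.trans
        ((congrArg F.map hb).trans (F.map_comp u b'))) =
      eqToHom ((F.map_comp a v).symm.trans ((congrArg F.map ha).trans (F.map_comp u a'))) ≫
        F.map u ◁ F.map₂ η' := by
  have h' := congrArg F.map₂ h
  simp only [F.map₂_comp, map₂_whiskerRight', map₂_whiskerLeft', PrelaxFunctor.map₂_eqToHom,
    Category.assoc, eqToHom_trans, eqToHom_trans_assoc] at h'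
  rw [← cancel_epi (eqToHom (F.map_comp a v)), ← cancel_mono (eqToHom (F.map_comp u b').symm)]
  simpa using h'

theorem square_symm {X Y : C} {a b a' b' : X ⟶ Y} {η : a ⟶ b} {η' : a' ⟶ b'} (ha : a = a')
    (hb : b = b') (h : η ≫ eqToHom hb = eqToHom ha ≫ η') :
    η' ≫ eqToHom hb.symm = eqToHom ha.symm ≫ η := by
  subst ha hb
  simpa using h.symm

/-- The 2-comonad `F ∘ G` induced by a 2-adjunction `F ⊣ G`. -/
def TwoAdjunction.comonad (adj : TwoAdjunction F G) : TwoComonad C where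
  fn := G.comp F
  counit := adj.counit
  comult :=
    { app := fun Y => F.map (adj.unit.app (G.obj Y))
      naturality := fun {X Y} f => by
        have h := congrArg F.map (adj.unit.naturality (G.map f))
        exact (F.map_comp _ _).symm.trans (h.trans (F.map_comp _ _))
      naturality₂ := fun {X Y f g} η => by
        have h := map₂_square F _ _ (adj.unit.naturality₂ (G.map₂ η))
        exact h }
  comult_counit := fun X => adj.left_triangle (G.obj X)
  comult_map_counit := fun X => by
    have h := congrArg F.map (adj.right_triangle X)
    exact (F.map_comp _ _).symm.trans (h.trans (F.map_id _))
  coassoc := fun X => by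
    have h := congrArg F.map (adj.unit.naturality (adj.unit.app (G.obj X)))
    exact (F.map_comp _ _).symm.trans (h.symm.trans (F.map_comp _ _))

end Adj

section Coalg

variable {C : Type u} [Bicategory.{w, v} C] [Bicategory.Strict C]

/-- A strict coalgebra of a 2-comonad. -/
structure Coalgebra (T : TwoComonad C) where
  obj : C
  str : obj ⟶ T.fn.obj obj
  counit : str ≫ T.counit.app obj = 𝟙 obj
  coassoc : str ≫ T.fn.map str = str ≫ T.comult.app obj

namespace Coalgebra

variable {T : TwoComonad C}

/-- A strict morphism of coalgebras. -/
@[ext]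
structure Hom (A B : Coalgebra T) where
  hom : A.obj ⟶ B.obj
  comm : A.str ≫ T.fn.map hom = hom ≫ B.str

/-- A 2-cell between coalgebra morphisms: a 2-cell of the ambient 2-category that is compatible
with the coalgebra structures. -/
@[ext]
structure Hom₂ {A B : Coalgebra T} (f g : Hom A B) where
  hom : f.hom ⟶ g.hom
  comm : A.str ◁ T.fn.map₂ hom ≫ eqToHom g.comm = eqToHom f.comm ≫ hom ▷ B.str

instance : CategoryStruct (Coalgebra T) where
  Hom A B := Hom A B
  id A := ⟨𝟙 A.obj, by rw [T.fn.map_id, Strict.comp_id, Strict.id_comp]⟩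
  comp {A B D} f g := ⟨f.hom ≫ g.hom, by
    rw [T.fn.map_comp, ← Strict.assoc, f.comm, Strict.assoc, g.comm, Strict.assoc]⟩

instance (A B : Coalgebra T) : Category (A ⟶ B) where
  Hom f g := Hom₂ f g
  id f := ⟨𝟙 f.hom, by simp⟩
  comp {f g h} a b := ⟨a.hom ≫ b.hom, by
    rw [T.fn.map₂_comp, whiskerLeft_comp, Category.assoc, b.comm, ← Category.assoc, a.comm,
      Category.assoc, comp_whiskerRight]⟩

@[simp]
theorem id_hom (A : Coalgebra T) : Hom.hom (𝟙 A) = 𝟙 A.obj := rfl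

@[simp]
theorem comp_hom {A B D : Coalgebra T} (f : A ⟶ B) (g : B ⟶ D) :
    Hom.hom (f ≫ g) = f.hom ≫ g.hom := rfl

@[simp]
theorem id_hom₂ {A B : Coalgebra T} (f : A ⟶ B) : Hom₂.hom (𝟙 f) = 𝟙 f.hom := rfl

@[simp]
theorem comp_hom₂ {A B : Coalgebra T} {f g h : A ⟶ B} (a : f ⟶ g) (b : g ⟶ h) :
    Hom₂.hom (a ≫ b) = a.hom ≫ b.hom := rfl

@[ext]
theorem hom_ext {A B : Coalgebra T} {f g : A ⟶ B} (h : f.hom = g.hom) : f = g := Hom.ext h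

@[ext]
theorem hom₂_ext {A B : Coalgebra T} {f g : A ⟶ B} {a b : f ⟶ g} (h : a.hom = b.hom) : a = b :=
  Hom₂.ext h

@[simp]
theorem eqToHom_hom {A B : Coalgebra T} {f g : A ⟶ B} (h : f = g) :
    (eqToHom h).hom = eqToHom (congrArg Hom.hom h) := by
  subst h; rfl

theorem whiskerLeft_comm {A B D : Coalgebra T} (f : A ⟶ B) {g h : B ⟶ D} (η : g ⟶ h) :
    A.str ◁ T.fn.map₂ (f.hom ◁ η.hom) ≫ eqToHom (f ≫ h).comm =
      eqToHom (f ≫ g).comm ≫ (f.hom ◁ η.hom) ▷ D.str := by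
  have h₁ : A.str ◁ T.fn.map f.hom ◁ T.fn.map₂ η.hom =
      eqToHom (by rw [← Strict.assoc, f.comm, Strict.assoc]) ≫
        f.hom ◁ B.str ◁ T.fn.map₂ η.hom ≫
          eqToHom (by rw [← Strict.assoc, ← f.comm, Strict.assoc]) := by
    have h := congr_whiskerLeft f.comm (T.fn.map₂ η.hom)
    simp only [Bicategory.comp_whiskerLeft, Strict.associator_eqToIso, eqToIso.hom, eqToIso.inv,
      Category.assoc] at h
    rw [← cancel_epi (eqToHom (Strict.assoc _ _ _)),
      ← cancel_mono (eqToHom (Strict.assoc _ _ _).symm)]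
    simpa using h
  have h₂ := congrArg (fun t => f.hom ◁ t) η.comm
  simp only [Bicategory.whiskerLeft_comp, Bicategory.whiskerLeft_eqToHom] at h₂
  rw [map₂_whiskerLeft']
  simp only [Bicategory.whiskerLeft_comp, Bicategory.whiskerLeft_eqToHom, h₁, Category.assoc,
    eqToHom_trans, eqToHom_trans_assoc, Bicategory.whisker_assoc, Strict.associator_eqToIso,
    eqToIso.hom, eqToIso.inv]
  rw [← cancel_mono (eqToHom (Strict.assoc f.hom h.hom D.str))]
  have h₃ := congrArg (fun t => eqToHom (by
    rw [T.fn.map_comp, ← Strict.assoc, f.comm, Strict.assoc] :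
      A.str ≫ T.fn.map (f.hom ≫ g.hom) = f.hom ≫ B.str ≫ T.fn.map g.hom) ≫ t) h₂
  simpa using h₃

theorem whiskerRight_comm {A B D : Coalgebra T} {f g : A ⟶ B} (η : f ⟶ g) (h : B ⟶ D) :
    A.str ◁ T.fn.map₂ (η.hom ▷ h.hom) ≫ eqToHom (g ≫ h).comm =
      eqToHom (f ≫ h).comm ≫ (η.hom ▷ h.hom) ▷ D.str := by
  have h₁ : η.hom ▷ B.str ▷ T.fn.map h.hom =
      eqToHom (by rw [Strict.assoc, h.comm, ← Strict.assoc]) ≫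
        η.hom ▷ h.hom ▷ D.str ≫
          eqToHom (by rw [Strict.assoc, ← h.comm, ← Strict.assoc]) := by
    have h := whiskerRight_congr h.comm η.hom
    simp only [Bicategory.whiskerRight_comp, Strict.associator_eqToIso, eqToIso.hom, eqToIso.inv,
      Category.assoc] at h
    rw [← cancel_epi (eqToHom (Strict.assoc _ _ _).symm),
      ← cancel_mono (eqToHom (Strict.assoc _ _ _))]
    simpa using h
  have h₂ := congrArg (fun t => t ▷ T.fn.map h.hom) η.comm
  simp only [Bicategory.comp_whiskerRight, Bicategory.eqToHom_whiskerRight, h₁,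
    Bicategory.whisker_assoc, Strict.associator_eqToIso, eqToIso.hom, eqToIso.inv,
    Category.assoc, eqToHom_trans, eqToHom_trans_assoc] at h₂
  rw [map₂_whiskerRight']
  simp only [Bicategory.whiskerLeft_comp, Bicategory.whiskerLeft_eqToHom, Category.assoc,
    eqToHom_trans]
  rw [← cancel_epi (eqToHom (by rw [T.fn.map_comp, ← Strict.assoc] :
      (A.str ≫ T.fn.map f.hom) ≫ T.fn.map h.hom = A.str ≫ T.fn.map (f.hom ≫ h.hom))),
    ← cancel_mono (eqToHom (by rw [Strict.assoc, ← h.comm, ← Strict.assoc] :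
      (g.hom ≫ h.hom) ≫ D.str = (g.hom ≫ B.str) ≫ T.fn.map h.hom))]
  simpa using h₂

/-- Left whiskering in the 2-category of coalgebras. -/
@[simps]
def whiskerL {A B D : Coalgebra T} (f : A ⟶ B) {g h : B ⟶ D} (η : g ⟶ h) :
    Hom₂ (f ≫ g) (f ≫ h) where
  hom := f.hom ◁ η.hom
  comm := whiskerLeft_comm f η

/-- Right whiskering in the 2-category of coalgebras. -/
@[simps]
def whiskerR {A B D : Coalgebra T} {f g : A ⟶ B} (η : f ⟶ g) (h : B ⟶ D) :
    Hom₂ (f ≫ h) (g ≫ h) where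
  hom := η.hom ▷ h.hom
  comm := whiskerRight_comm η h

/-- The strict 2-category of coalgebras, coalgebra morphisms and their 2-cells. -/
instance : Bicategory (Coalgebra T) where
  homCategory A B := inferInstance
  whiskerLeft f _ _ η := whiskerL f η
  whiskerRight η h := whiskerR η h
  associator f g h := eqToIso (hom_ext (Strict.assoc (Hom.hom f) (Hom.hom g) (Hom.hom h)))
  leftUnitor f := eqToIso (hom_ext (Strict.id_comp (Hom.hom f)))
  rightUnitor f := eqToIso (hom_ext (Strict.comp_id (Hom.hom f)))
  whiskerLeft_id f g := by ext; simp
  whiskerLeft_comp f _ _ _ a b := by ext; simp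
  id_whiskerLeft a := by ext; simp [Strict.leftUnitor_eqToIso]
  comp_whiskerLeft f g _ _ a := by ext; simp [Strict.associator_eqToIso]
  id_whiskerRight f g := by ext; simp
  comp_whiskerRight a b f := by ext; simp
  whiskerRight_id a := by ext; simp [Strict.rightUnitor_eqToIso]
  whiskerRight_comp a f g := by ext; simp [Strict.associator_eqToIso]
  whisker_assoc f _ _ a g := by ext; simp [Strict.associator_eqToIso]
  whisker_exchange a b := by ext; exact whisker_exchange (Hom₂.hom a) (Hom₂.hom b)
  pentagon f g h i := by ext; simp
  triangle f g := by ext; simp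

instance : Bicategory.Strict (Coalgebra T) where
  id_comp f := hom_ext (Strict.id_comp (Hom.hom f))
  comp_id f := hom_ext (Strict.comp_id (Hom.hom f))
  assoc f g h := hom_ext (Strict.assoc (Hom.hom f) (Hom.hom g) (Hom.hom h))
  leftUnitor_eqToIso _ := rfl
  rightUnitor_eqToIso _ := rfl
  associator_eqToIso _ _ _ := rfl

end Coalgebra

end Coalg

/-- A 2-comonad is KZ if the structure 1-cell of each coalgebra is left adjoint to the counit, with
the identity 2-cell as unit of the adjunction. -/
def TwoComonad.IsKZ {C : Type u} [Bicategory.{w, v} C] [Bicategory.Strict C]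
    (T : TwoComonad C) : Prop :=
  ∀ A : Coalgebra T,
    ∃ a : Bicategory.Adjunction A.str (T.counit.app A.obj : T.fn.obj A.obj ⟶ A.obj),
      a.unit = eqToHom A.counit.symm

/-- The comparison 2-functor of a 2-adjunction `F ⊣ G` into the 2-category of coalgebras of the
induced 2-comonad; it sends `X` to the coalgebra `F η_X : F X ⟶ F G F X`. -/
def TwoAdjunction.comparison {B : Type u₁} [Bicategory.{w₁, v₁} B] [Bicategory.Strict B]
    {C : Type u₂} [Bicategory.{w₂, v₂} C] [Bicategory.Strict C]
    {F : StrictPseudofunctor B C} {G : StrictPseudofunctor C B} (adj : TwoAdjunction F G) :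
    StrictPseudofunctor B (Coalgebra adj.comonad) :=
  StrictPseudofunctor.mk''
    { obj := fun X =>
        { obj := F.obj X
          str := F.map (adj.unit.app X)
          counit := adj.left_triangle X
          coassoc := by
            have h := congrArg F.map (adj.unit.naturality (adj.unit.app X))
            exact (F.map_comp _ _).symm.trans (h.symm.trans (F.map_comp _ _)) }
      map := fun {X Y} f => Coalgebra.Hom.mk (F.map f) (by
        have h := congrArg F.map (adj.unit.naturality f)
        exact (F.map_comp _ _).symm.trans (h.symm.trans (F.map_comp _ _)))
      map₂ := fun {X Y f g} η => Coalgebra.Hom₂.mk (F.map₂ η) (by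
        exact square_symm _ _ (map₂_square F _ _ (adj.unit.naturality₂ η)))
      map₂_id := fun f => Coalgebra.hom₂_ext (F.map₂_id f)
      map₂_comp := fun η θ => Coalgebra.hom₂_ext (F.map₂_comp η θ)
      map_id := fun X => Coalgebra.hom_ext (F.map_id X)
      map_comp := fun f g => Coalgebra.hom_ext (F.map_comp f g)
      map₂_whisker_left := fun f _ _ η => Coalgebra.hom₂_ext (by
        simp only [Coalgebra.comp_hom₂, Coalgebra.eqToHom_hom]
        exact map₂_whiskerLeft' F f η)
      map₂_whisker_right := fun η f => Coalgebra.hom₂_ext (by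
        simp only [Coalgebra.comp_hom₂, Coalgebra.eqToHom_hom]
        exact map₂_whiskerRight' F η f) }

/-- A 2-functor is an isomorphism of 2-categories if it is bijective on objects, on 1-cells and on
2-cells. -/
structure IsTwoIso {B : Type u₁} [Bicategory.{w₁, v₁} B] {C : Type u₂} [Bicategory.{w₂, v₂} C]
    (F : StrictPseudofunctor B C) : Prop where
  obj : Function.Bijective F.obj
  map (X Y : B) : Function.Bijective (fun f : X ⟶ Y => F.map f)
  map₂ {X Y : B} (f g : X ⟶ Y) : Function.Bijective (fun η : f ⟶ g => F.map₂ η)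

/-- Data for a 2-category whose objects are indexed by `B`, lying over the objects of `C` through
`obj`, with 1-cells those 1-cells of `C` that satisfy `P`, and all 2-cells of `C` between them. -/
structure OneCells (B : Type u₁) (C : Type u₂) [Bicategory.{w₂, v₂} C] where
  obj : B → C
  P (X Y : B) : (obj X ⟶ obj Y) → Prop
  id_mem (X : B) : P X X (𝟙 (obj X))
  comp_mem {X Y Z : B} (f : obj X ⟶ obj Y) (g : obj Y ⟶ obj Z) : P X Y f → P Y Z g →
    P X Z (f ≫ g)

/-- The objects of the 2-category given by `W`. -/
structure LocallyFull {B : Type u₁} {C : Type u₂} [Bicategory.{w₂, v₂} C] (W : OneCells B C) where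
  as : B

namespace LocallyFull

variable {B : Type u₁} {C : Type u₂} [Bicategory.{w₂, v₂} C] {W : OneCells B C}

/-- The 1-cells. -/
@[ext]
structure Hom (X Y : LocallyFull W) where
  hom : W.obj X.as ⟶ W.obj Y.as
  mem : W.P X.as Y.as hom

/-- The 2-cells. -/
@[ext]
structure Hom₂ {X Y : LocallyFull W} (f g : Hom X Y) where
  hom : f.hom ⟶ g.hom

instance : CategoryStruct (LocallyFull W) where
  Hom X Y := Hom X Y
  id X := ⟨𝟙 (W.obj X.as), W.id_mem X.as⟩
  comp f g := ⟨f.hom ≫ g.hom, W.comp_mem f.hom g.hom f.mem g.mem⟩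

instance (X Y : LocallyFull W) : Category (X ⟶ Y) where
  Hom f g := Hom₂ f g
  id f := ⟨𝟙 f.hom⟩
  comp a b := ⟨a.hom ≫ b.hom⟩

@[simp]
theorem id_hom (X : LocallyFull W) : Hom.hom (𝟙 X) = 𝟙 (W.obj X.as) := rfl

@[simp]
theorem comp_hom {X Y Z : LocallyFull W} (f : X ⟶ Y) (g : Y ⟶ Z) :
    Hom.hom (f ≫ g) = f.hom ≫ g.hom := rfl

@[simp]
theorem id_hom₂ {X Y : LocallyFull W} (f : X ⟶ Y) : Hom₂.hom (𝟙 f) = 𝟙 f.hom := rfl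

@[simp]
theorem comp_hom₂ {X Y : LocallyFull W} {f g h : X ⟶ Y} (a : f ⟶ g) (b : g ⟶ h) :
    Hom₂.hom (a ≫ b) = a.hom ≫ b.hom := rfl

@[ext]
theorem hom_ext {X Y : LocallyFull W} {f g : X ⟶ Y} (h : f.hom = g.hom) : f = g := Hom.ext h

@[ext]
theorem hom₂_ext {X Y : LocallyFull W} {f g : X ⟶ Y} {a b : f ⟶ g} (h : a.hom = b.hom) : a = b :=
  Hom₂.ext h

@[simp]
theorem eqToHom_hom {X Y : LocallyFull W} {f g : X ⟶ Y} (h : f = g) :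
    (eqToHom h).hom = eqToHom (congrArg Hom.hom h) := by
  subst h; rfl

/-- Invertible 2-cells of the ambient 2-category are invertible here. -/
@[simps]
def isoMk {X Y : LocallyFull W} {f g : X ⟶ Y} (e : f.hom ≅ g.hom) : f ≅ g where
  hom := Hom₂.mk e.hom
  inv := Hom₂.mk e.inv
  hom_inv_id := hom₂_ext e.hom_inv_id
  inv_hom_id := hom₂_ext e.inv_hom_id

instance : Bicategory (LocallyFull W) where
  homCategory X Y := inferInstance
  whiskerLeft f _ _ η := Hom₂.mk (Hom.hom f ◁ Hom₂.hom η)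
  whiskerRight η h := Hom₂.mk (Hom₂.hom η ▷ Hom.hom h)
  associator f g h := isoMk (α_ (Hom.hom f) (Hom.hom g) (Hom.hom h))
  leftUnitor f := isoMk (λ_ (Hom.hom f))
  rightUnitor f := isoMk (ρ_ (Hom.hom f))
  whiskerLeft_id f g := by ext; simp
  whiskerLeft_comp f _ _ _ a b := by ext; simp
  id_whiskerLeft a := by ext; simp
  comp_whiskerLeft f g _ _ a := by ext; simp
  id_whiskerRight f g := by ext; simp
  comp_whiskerRight a b f := by ext; simp
  whiskerRight_id a := by ext; simp
  whiskerRight_comp a f g := by ext; simp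
  whisker_assoc f _ _ a g := by ext; simp
  whisker_exchange a b := by ext; exact whisker_exchange (Hom₂.hom a) (Hom₂.hom b)
  pentagon f g h i := by ext; simp
  triangle f g := by ext; simp

instance [Bicategory.Strict C] : Bicategory.Strict (LocallyFull W) where
  id_comp f := hom_ext (Strict.id_comp (Hom.hom f))
  comp_id f := hom_ext (Strict.comp_id (Hom.hom f))
  assoc f g h := hom_ext (Strict.assoc (Hom.hom f) (Hom.hom g) (Hom.hom h))
  leftUnitor_eqToIso f := by
    ext
    rw [eqToIso.hom, eqToHom_hom]
    exact congrArg Iso.hom (Strict.leftUnitor_eqToIso (Hom.hom f))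
  rightUnitor_eqToIso f := by
    ext
    rw [eqToIso.hom, eqToHom_hom]
    exact congrArg Iso.hom (Strict.rightUnitor_eqToIso (Hom.hom f))
  associator_eqToIso f g h := by
    ext
    rw [eqToIso.hom, eqToHom_hom]
    exact congrArg Iso.hom (Strict.associator_eqToIso (Hom.hom f) (Hom.hom g) (Hom.hom h))

end LocallyFull

end TwoCat

namespace Doctrines

open CategoryTheory Bicategory MonoidalCategory CartesianMonoidalCategory Opposite TwoCat
open Limits (PreservesFiniteProducts)

/-- A doctrine: a category with (chosen) finite products and a functor from its opposite to
posets. -/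
structure Doctrine where
  base : Type u
  [cat : Category.{v} base]
  [cart : CartesianMonoidalCategory base]
  fib : baseᵒᵖ ⥤ PartOrd.{w}

attribute [instance] Doctrine.cat Doctrine.cart

namespace Doctrine

/-- The fibre over an object. -/
abbrev Fib (P : Doctrine.{w, v, u}) (X : P.base) : Type w := P.fib.obj (op X)

/-- Reindexing along an arrow of the base. -/
def re (P : Doctrine.{w, v, u}) {X Y : P.base} (f : X ⟶ Y) (α : P.Fib Y) : P.Fib X :=
  P.fib.map f.op α

theorem re_mono (P : Doctrine.{w, v, u}) {X Y : P.base} (f : X ⟶ Y) {α β : P.Fib Y} (h : α ≤ β) :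
    P.re f α ≤ P.re f β :=
  (P.fib.map f.op).hom.monotone h

theorem re_id (P : Doctrine.{w, v, u}) {X : P.base} (α : P.Fib X) : P.re (𝟙 X) α = α := by
  simp [re]

theorem re_re (P : Doctrine.{w, v, u}) {X Y Z : P.base} (f : X ⟶ Y) (g : Y ⟶ Z) (α : P.Fib Z) :
    P.re f (P.re g α) = P.re (f ≫ g) α := by
  simp [re]

/-- A 1-arrow of doctrines: a finite product preserving functor between the bases and a natural
family of monotone maps between the fibres. -/
@[ext]
structure Hom (P Q : Doctrine.{w, v, u}) where
  fn : P.base ⥤ Q.base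
  pres : PreservesFiniteProducts fn
  nt : P.fib ⟶ fn.op ⋙ Q.fib

attribute [instance] Hom.pres

/-- The action of a 1-arrow on the fibre over `X`. -/
def Hom.on {P Q : Doctrine.{w, v, u}} (F : Hom P Q) {X : P.base} (α : P.Fib X) :
    Q.Fib (F.fn.obj X) :=
  F.nt.app (op X) α

/-- A 2-arrow `F ⟶ G` of doctrines: a natural transformation `θ` between the functors on the bases
such that `F_X ≤ Q(θ_X) ∘ G_X` for each object `X`. -/
@[ext]
structure Hom₂ {P Q : Doctrine.{w, v, u}} (F G : Hom P Q) where
  nat : F.fn ⟶ G.fn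
  le (X : P.base) (α : P.Fib X) : F.on α ≤ Q.re (nat.app X) (G.on α)

instance : CategoryStruct Doctrine.{w, v, u} where
  Hom P Q := Hom P Q
  id P := ⟨𝟭 P.base, inferInstance, 𝟙 P.fib⟩
  comp F G := ⟨F.fn ⋙ G.fn, inferInstance, F.nt ≫ F.fn.op.whiskerLeft G.nt⟩

instance (P Q : Doctrine.{w, v, u}) : Category (P ⟶ Q) where
  Hom F G := Hom₂ F G
  id F := ⟨𝟙 F.fn, fun X α => by simp [re_id]⟩
  comp {F G H} a b := ⟨a.nat ≫ b.nat, fun X α => by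
    rw [NatTrans.comp_app, ← re_re]
    exact (a.le X α).trans (Q.re_mono _ (b.le X α))⟩

@[simp]
theorem id_nat {P Q : Doctrine.{w, v, u}} (F : P ⟶ Q) : Hom₂.nat (𝟙 F) = 𝟙 F.fn := rfl

@[simp]
theorem comp_nat {P Q : Doctrine.{w, v, u}} {F G H : P ⟶ Q} (a : F ⟶ G) (b : G ⟶ H) :
    Hom₂.nat (a ≫ b) = a.nat ≫ b.nat := rfl

@[simp]
theorem id_fn (P : Doctrine.{w, v, u}) : Hom.fn (𝟙 P) = 𝟭 P.base := rfl

@[simp]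
theorem comp_fn {P Q S : Doctrine.{w, v, u}} (F : P ⟶ Q) (G : Q ⟶ S) :
    Hom.fn (F ≫ G) = F.fn ⋙ G.fn := rfl

@[simp]
theorem comp_on {P Q S : Doctrine.{w, v, u}} (F : P ⟶ Q) (G : Q ⟶ S) {X : P.base} (α : P.Fib X) :
    Hom.on (F ≫ G) α = G.on (F.on α) := rfl

@[simp]
theorem id_on (P : Doctrine.{w, v, u}) {X : P.base} (α : P.Fib X) : Hom.on (𝟙 P) α = α := rfl

theorem Hom.on_mono {P Q : Doctrine.{w, v, u}} (F : Hom P Q) {X : P.base} {α β : P.Fib X}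
    (h : α ≤ β) : F.on α ≤ F.on β :=
  (F.nt.app (op X)).hom.monotone h

theorem Hom.on_re {P Q : Doctrine.{w, v, u}} (F : Hom P Q) {X Y : P.base} (f : X ⟶ Y)
    (α : P.Fib Y) : F.on (P.re f α) = Q.re (F.fn.map f) (F.on α) :=
  ConcreteCategory.congr_hom (F.nt.naturality f.op) α

@[ext]
theorem hom₂_ext {P Q : Doctrine.{w, v, u}} {F G : P ⟶ Q} {a b : F ⟶ G} (h : a.nat = b.nat) :
    a = b := Hom₂.ext h

/-- Left whiskering. -/
@[simps]
def whiskerL {P Q S : Doctrine.{w, v, u}} (F : P ⟶ Q) {G H : Q ⟶ S} (a : G ⟶ H) :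
    Hom₂ (F ≫ G) (F ≫ H) where
  nat := F.fn.whiskerLeft a.nat
  le X α := Hom₂.le a (F.fn.obj X) (F.on α)

/-- Right whiskering. -/
@[simps]
def whiskerR {P Q S : Doctrine.{w, v, u}} {F G : P ⟶ Q} (a : F ⟶ G) (H : Q ⟶ S) :
    Hom₂ (F ≫ H) (G ≫ H) where
  nat := Functor.whiskerRight a.nat H.fn
  le X α := by
    have h := H.on_mono (Hom₂.le a X α)
    rw [H.on_re] at h
    exact h

/-- The invertible 2-arrow with identity components between equal 1-arrows. -/
def idIso {P Q : Doctrine.{w, v, u}} {F G : P ⟶ Q} (h : F = G) : F ≅ G where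
  hom := Hom₂.mk (eqToHom (congrArg Hom.fn h)) (fun X α => by subst h; simp [re_id])
  inv := Hom₂.mk (eqToHom (congrArg Hom.fn h.symm)) (fun X α => by subst h; simp [re_id])
  hom_inv_id := by ext; simp
  inv_hom_id := by ext; simp

/-- The 2-category of doctrines. -/
instance : Bicategory Doctrine.{w, v, u} where
  homCategory P Q := inferInstance
  whiskerLeft F _ _ a := whiskerL F a
  whiskerRight a H := whiskerR a H
  associator F G H := idIso (F := (F ≫ G) ≫ H) (G := F ≫ G ≫ H) rfl
  leftUnitor {P Q} F := idIso (F := 𝟙 P ≫ F) (G := F) rfl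
  rightUnitor {P Q} F := idIso (F := F ≫ 𝟙 Q) (G := F) rfl
  whiskerLeft_id F G := by ext; simp
  whiskerLeft_comp F _ _ _ a b := by ext; simp
  id_whiskerLeft a := by
    ext X; exact ((Category.id_comp _).trans (Category.comp_id _)).symm
  comp_whiskerLeft F G _ _ a := by
    ext X; exact ((Category.id_comp _).trans (Category.comp_id _)).symm
  id_whiskerRight F G := by ext; simp
  comp_whiskerRight a b F := by ext; simp
  whiskerRight_id a := by
    ext X; exact ((Category.id_comp _).trans (Category.comp_id _)).symm
  whiskerRight_comp a F G := by
    ext X; exact ((Category.id_comp _).trans (Category.comp_id _)).symm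
  whisker_assoc F _ _ a G := by
    ext X; exact ((Category.id_comp _).trans (Category.comp_id _)).symm
  whisker_exchange a b := by ext; simp
  pentagon F G H I := by
    ext X
    exact (by simp : I.fn.map (𝟙 (H.fn.obj (G.fn.obj (F.fn.obj X)))) ≫ 𝟙 _ ≫ 𝟙 _ = 𝟙 _ ≫ 𝟙 _)
  triangle F G := by
    ext X
    exact (by simp : 𝟙 _ ≫ 𝟙 _ = G.fn.map (𝟙 (F.fn.obj X)))

instance : Bicategory.Strict Doctrine.{w, v, u} where
  id_comp _ := rfl
  comp_id _ := rfl
  assoc _ _ _ := rfl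
  leftUnitor_eqToIso _ := rfl
  rightUnitor_eqToIso _ := rfl
  associator_eqToIso _ _ _ := rfl

end Doctrine
/-- A resource semiring: a semiring with a partial order for which addition and multiplication are
monotone. -/
class ResourceSemiring (R : Type x) extends Semiring R, PartialOrder R where
  add_mono {a b c d : R} : a ≤ b → c ≤ d → a + c ≤ b + d
  mul_mono {a b c d : R} : a ≤ b → c ≤ d → a * c ≤ b * d

section Projections

variable {C : Type u} [Category.{v} C] [CartesianMonoidalCategory C]

/-- The diagonal. -/
def diag (A : C) : A ⟶ A ⊗ A := lift (𝟙 A) (𝟙 A)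

/-- The arrow `⟨π₂, π₁⟩`. -/
def swap (A B : C) : A ⊗ B ⟶ B ⊗ A := lift (snd A B) (fst A B)

/-- The arrow `⟨π₁, π₂⟩` out of a ternary product. -/
def p₁₂ (X A B : C) : X ⊗ (A ⊗ B) ⟶ X ⊗ A := lift (fst X (A ⊗ B)) (snd X (A ⊗ B) ≫ fst A B)

/-- The arrow `⟨π₁, π₃⟩` out of a ternary product. -/
def p₁₃ (X A B : C) : X ⊗ (A ⊗ B) ⟶ X ⊗ B := lift (fst X (A ⊗ B)) (snd X (A ⊗ B) ≫ snd A B)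

/-- The arrow `⟨π₂, π₃⟩` out of a ternary product. -/
def p₂₃ (X A B : C) : X ⊗ (A ⊗ B) ⟶ A ⊗ B := snd X (A ⊗ B)

/-- The arrow `⟨π₁, π₃⟩` out of `A × X × A × X`. -/
def q₁₃ (A X : C) : (A ⊗ X) ⊗ (A ⊗ X) ⟶ A ⊗ A :=
  lift (fst (A ⊗ X) (A ⊗ X) ≫ fst A X) (snd (A ⊗ X) (A ⊗ X) ≫ fst A X)

/-- The arrow `⟨π₂, π₄⟩` out of `A × X × A × X`. -/
def q₂₄ (A X : C) : (A ⊗ X) ⊗ (A ⊗ X) ⟶ X ⊗ X :=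
  lift (fst (A ⊗ X) (A ⊗ X) ≫ snd A X) (snd (A ⊗ X) (A ⊗ X) ≫ snd A X)

end Projections

/-- A primary linear doctrine: each fibre is an ordered commutative monoid `(⋆, κ)`, and these
operations are preserved by reindexing. -/
structure LinearDoctrine extends Doctrine.{w, v, u} where
  tens {X : base} : toDoctrine.Fib X → toDoctrine.Fib X → toDoctrine.Fib X
  one (X : base) : toDoctrine.Fib X
  tens_mono {X : base} {α α' β β' : toDoctrine.Fib X} :
    α ≤ α' → β ≤ β' → tens α β ≤ tens α' β'
  tens_assoc {X : base} (α β γ : toDoctrine.Fib X) : tens (tens α β) γ = tens α (tens β γ)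
  tens_comm {X : base} (α β : toDoctrine.Fib X) : tens α β = tens β α
  one_tens {X : base} (α : toDoctrine.Fib X) : tens (one X) α = α
  re_tens {X Y : base} (f : X ⟶ Y) (α β : toDoctrine.Fib Y) :
    toDoctrine.re f (tens α β) = tens (toDoctrine.re f α) (toDoctrine.re f β)
  re_one {X Y : base} (f : X ⟶ Y) : toDoctrine.re f (one Y) = one X

namespace LinearDoctrine

/-- `ρ` is a distance on `A`. -/
structure IsDistance (P : LinearDoctrine.{w, v, u}) {A : P.base} (ρ : P.Fib (A ⊗ A)) : Prop where
  refl : P.one A ≤ P.re (diag A) ρ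
  symm : ρ ≤ P.re (swap A A) ρ
  trans : P.tens (P.re (p₁₂ A A A) ρ) (P.re (p₂₃ A A A) ρ) ≤ P.re (p₁₃ A A A) ρ

/-- `δ` is an equality predicate on `A`: it is reflexive and substitutive. -/
structure IsEqPred (P : LinearDoctrine.{w, v, u}) {A : P.base} (δ : P.Fib (A ⊗ A)) : Prop where
  refl : P.one A ≤ P.re (diag A) δ
  subst (X : P.base) (α : P.Fib (X ⊗ A)) :
    P.tens (P.re (p₁₂ X A A) α) (P.re (p₂₃ X A A) δ) ≤ P.re (p₁₃ X A A) α

/-- A primary linear doctrine is elementary if each object has an equality predicate. -/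
def IsElementary (P : LinearDoctrine.{w, v, u}) : Prop :=
  ∀ A : P.base, ∃ δ : P.Fib (A ⊗ A), P.IsEqPred δ

namespace IsEqPred

variable {P : LinearDoctrine.{w, v, u}} {A : P.base} {δ : P.Fib (A ⊗ A)}

theorem subst_at (h : P.IsEqPred δ) {Z X : P.base} (k : Z ⟶ X) (f g : Z ⟶ A)
    (α : P.Fib (X ⊗ A)) :
    P.tens (P.re (lift k f) α) (P.re (lift f g) δ) ≤ P.re (lift k g) α := by
  have h' := P.re_mono (lift k (lift f g)) (h.subst X α)
  rw [P.re_tens, P.re_re, P.re_re, P.re_re] at h'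
  convert h' using 3 <;> simp [p₁₂, p₂₃, p₁₃, comp_lift]

theorem le_of_refl (h : P.IsEqPred δ) {α : P.Fib (A ⊗ A)} (hα : P.one A ≤ P.re (diag A) α) :
    δ ≤ α := by
  have h₁ := h.subst_at (fst A A) (fst A A) (snd A A) α
  have h₂ : P.one (A ⊗ A) ≤ P.re (lift (fst A A) (fst A A)) α := by
    have h₃ := P.re_mono (fst A A) hα
    rw [P.re_one, P.re_re] at h₃
    convert h₃ using 2
    simp [diag, comp_lift]
  rw [lift_fst_snd, P.re_id, P.re_id] at h₁
  have h₄ := (P.tens_mono h₂ (le_refl δ)).trans h₁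
  rwa [P.one_tens] at h₄

theorem unique (h : P.IsEqPred δ) {δ' : P.Fib (A ⊗ A)} (h' : P.IsEqPred δ') : δ = δ' :=
  le_antisymm (h.le_of_refl h'.refl) (h'.le_of_refl h.refl)

theorem isDistance (h : P.IsEqPred δ) : P.IsDistance δ where
  refl := h.refl
  symm := h.le_of_refl (by
    rw [P.re_re]
    convert h.refl using 2
    simp [diag, swap, comp_lift])
  trans := h.subst A δ

theorem affine (h : P.IsEqPred δ) : δ ≤ P.one (A ⊗ A) :=
  h.le_of_refl (by rw [P.re_one])

theorem tens_le_left {X : P.base} {α β : P.Fib X} (h : β ≤ P.one X) : P.tens α β ≤ α := by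
  have h' := P.tens_mono (le_refl α) h
  rwa [P.tens_comm α (P.one X), P.one_tens] at h'

theorem prod (h : P.IsEqPred δ) {X : P.base} {τ : P.Fib (X ⊗ X)} (hτ : P.IsEqPred τ)
    {ζ : P.Fib ((A ⊗ X) ⊗ (A ⊗ X))} (hζ : P.IsEqPred ζ) :
    ζ = P.tens (P.re (q₁₃ A X) δ) (P.re (q₂₄ A X) τ) := by
  apply le_antisymm
  · apply hζ.le_of_refl
    rw [P.re_tens, P.re_re, P.re_re]
    have h₁ := P.re_mono (fst A X) h.refl
    have h₂ := P.re_mono (snd A X) hτ.refl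
    rw [P.re_one, P.re_re] at h₁ h₂
    have h₃ := P.tens_mono h₁ h₂
    rw [P.one_tens] at h₃
    convert h₃ using 3 <;> simp [diag, q₁₃, q₂₄, comp_lift]
  · have h₁ := h.subst_at
      (lift (fst (A ⊗ X) (A ⊗ X)) (fst (A ⊗ X) (A ⊗ X) ≫ snd A X))
      (fst (A ⊗ X) (A ⊗ X) ≫ fst A X) (snd (A ⊗ X) (A ⊗ X) ≫ fst A X)
      (P.re (lift (fst _ A ≫ fst (A ⊗ X) X) (lift (snd _ A) (fst _ A ≫ snd (A ⊗ X) X))) ζ)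
    have h₂ := hτ.subst_at
      (lift (fst (A ⊗ X) (A ⊗ X)) (snd (A ⊗ X) (A ⊗ X) ≫ fst A X))
      (fst (A ⊗ X) (A ⊗ X) ≫ snd A X) (snd (A ⊗ X) (A ⊗ X) ≫ snd A X)
      (P.re (lift (fst _ X ≫ fst (A ⊗ X) A) (lift (fst _ X ≫ snd (A ⊗ X) A) (snd _ X))) ζ)
    rw [P.re_re, P.re_re] at h₁ h₂
    have e₁ : lift (lift (fst (A ⊗ X) (A ⊗ X)) (fst (A ⊗ X) (A ⊗ X) ≫ snd A X))
        (fst (A ⊗ X) (A ⊗ X) ≫ fst A X) ≫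
          lift (fst _ A ≫ fst (A ⊗ X) X) (lift (snd _ A) (fst _ A ≫ snd (A ⊗ X) X)) =
        fst (A ⊗ X) (A ⊗ X) ≫ diag (A ⊗ X) := by
      ext <;> simp [diag]
    have e₂ : lift (lift (fst (A ⊗ X) (A ⊗ X)) (snd (A ⊗ X) (A ⊗ X) ≫ fst A X))
        (fst (A ⊗ X) (A ⊗ X) ≫ snd A X) ≫
          lift (fst _ X ≫ fst (A ⊗ X) A) (lift (fst _ X ≫ snd (A ⊗ X) A) (snd _ X)) =
        lift (lift (fst (A ⊗ X) (A ⊗ X)) (fst (A ⊗ X) (A ⊗ X) ≫ snd A X))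
        (snd (A ⊗ X) (A ⊗ X) ≫ fst A X) ≫
          lift (fst _ A ≫ fst (A ⊗ X) X) (lift (snd _ A) (fst _ A ≫ snd (A ⊗ X) X)) := by
      ext <;> simp
    have e₃ : lift (lift (fst (A ⊗ X) (A ⊗ X)) (snd (A ⊗ X) (A ⊗ X) ≫ fst A X))
        (snd (A ⊗ X) (A ⊗ X) ≫ snd A X) ≫
          lift (fst _ X ≫ fst (A ⊗ X) A) (lift (fst _ X ≫ snd (A ⊗ X) A) (snd _ X)) =
        𝟙 _ := by
      ext <;> simp
    rw [e₂, e₃, P.re_id] at h₂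
    rw [e₁, ← P.re_re] at h₁
    have h₀ := P.re_mono (fst (A ⊗ X) (A ⊗ X)) hζ.refl
    rw [P.re_one] at h₀
    have h₃ := (P.tens_mono h₀ (le_refl (P.re (q₁₃ A X) δ))).trans h₁
    rw [P.one_tens] at h₃
    exact (P.tens_mono h₃ (le_refl (P.re (q₂₄ A X) τ))).trans h₂

theorem unit_eq {δ : P.Fib (𝟙_ P.base ⊗ 𝟙_ P.base)} (h : P.IsEqPred δ) :
    δ = P.one (𝟙_ P.base ⊗ 𝟙_ P.base) := by
  apply le_antisymm h.affine
  have h₁ := P.re_mono (fst (𝟙_ P.base) (𝟙_ P.base)) h.refl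
  rw [P.re_one, P.re_re] at h₁
  have e : fst (𝟙_ P.base) (𝟙_ P.base) ≫ diag (𝟙_ P.base) = 𝟙 _ := by
    ext
  rwa [e, P.re_id] at h₁

end IsEqPred

end LinearDoctrine

/-- An `R`-graded doctrine: a primary linear doctrine with an `R`-graded linear exponential
modality. -/
structure GradedDoctrine (R : Type x) [ResourceSemiring R] extends
    LinearDoctrine.{w, v, u} where
  mod (r : R) {X : base} : toDoctrine.Fib X → toDoctrine.Fib X
  mod_mono (r : R) {X : base} {α β : toDoctrine.Fib X} : α ≤ β → mod r α ≤ mod r β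
  re_mod (r : R) {X Y : base} (f : X ⟶ Y) (α : toDoctrine.Fib Y) :
    toDoctrine.re f (mod r α) = mod r (toDoctrine.re f α)
  one_le_mod (r : R) (X : base) : one X ≤ mod r (one X)
  mod_tens_le (r : R) {X : base} (α β : toDoctrine.Fib X) :
    tens (mod r α) (mod r β) ≤ mod r (tens α β)
  weakening {X : base} (α : toDoctrine.Fib X) : mod 0 α ≤ one X
  contraction (r s : R) {X : base} (α : toDoctrine.Fib X) :
    mod (r + s) α ≤ tens (mod r α) (mod s α)
  counit {X : base} (α : toDoctrine.Fib X) : mod 1 α ≤ α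
  comult (r s : R) {X : base} (α : toDoctrine.Fib X) : mod (r * s) α ≤ mod r (mod s α)
  contravariance {r s : R} {X : base} (α : toDoctrine.Fib X) : s ≤ r → mod r α ≤ mod s α

variable {R : Type x} [ResourceSemiring R]

/-- An element of a fibre of a graded doctrine is intuitionistic if it is below all its
modalities. -/
def GradedDoctrine.IsIntuitionistic (P : GradedDoctrine.{w, v, u} R) {X : P.base}
    (α : P.Fib X) : Prop :=
  ∀ r : R, α ≤ P.mod r α

/-- 1-arrows of graded doctrines: 1-arrows of doctrines preserving the monoid structure on the
fibres and the modalities. -/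
structure IsGradedHom (P Q : GradedDoctrine.{w, v, u} R)
    (F : P.toDoctrine ⟶ Q.toDoctrine) : Prop where
  tens {X : P.base} (α β : P.Fib X) : F.on (P.tens α β) = Q.tens (F.on α) (F.on β)
  one (X : P.base) : F.on (P.one X) = Q.one (F.fn.obj X)
  mod (r : R) {X : P.base} (α : P.Fib X) : F.on (P.mod r α) = Q.mod r (F.on α)

theorem IsGradedHom.id (P : GradedDoctrine.{w, v, u} R) : IsGradedHom P P (𝟙 P.toDoctrine) where
  tens _ _ := rfl
  one _ := rfl
  mod _ _ _ := rfl

theorem IsGradedHom.comp {P Q S : GradedDoctrine.{w, v, u} R} {F : P.toDoctrine ⟶ Q.toDoctrine}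
    {G : Q.toDoctrine ⟶ S.toDoctrine} (hF : IsGradedHom P Q F) (hG : IsGradedHom Q S G) :
    IsGradedHom P S (F ≫ G) where
  tens α β := by simp only [Doctrine.comp_on, hF.tens, hG.tens]
  one X := by simp only [Doctrine.comp_on, hF.one, hG.one]; rfl
  mod r X α := by simp only [Doctrine.comp_on, hF.mod, hG.mod]

/-- An `R`-Lipschitz doctrine. -/
structure LipschitzDoctrine (R : Type x) [ResourceSemiring R] extends
    GradedDoctrine.{w, v, u} R where
  dist (A : base) : toDoctrine.Fib (A ⊗ A)
  isDistance (A : base) : toLinearDoctrine.IsDistance (dist A)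
  subst (A X : base) (α : toDoctrine.Fib (X ⊗ A)) :
    ∃ r : R, tens (toDoctrine.re (p₁₂ X A A) α) (mod r (toDoctrine.re (p₂₃ X A A) (dist A))) ≤
      toDoctrine.re (p₁₃ X A A) α
  dist_prod (A X : base) : dist (A ⊗ X) =
    tens (toDoctrine.re (q₁₃ A X) (dist A)) (toDoctrine.re (q₂₄ A X) (dist X))
  dist_prod_le_left (A X : base) : dist (A ⊗ X) ≤ toDoctrine.re (q₁₃ A X) (dist A)
  dist_prod_le_right (A X : base) : dist (A ⊗ X) ≤ toDoctrine.re (q₂₄ A X) (dist X)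
  dist_unit : dist (𝟙_ base) = one (𝟙_ base ⊗ 𝟙_ base)

/-- 1-arrows of Lipschitz doctrines: 1-arrows of graded doctrines preserving the distances, up to
the canonical isomorphism `F (A × A) ≅ F A × F A`. -/
structure IsLipschitzHom (P Q : LipschitzDoctrine.{w, v, u} R)
    (F : P.toDoctrine ⟶ Q.toDoctrine) : Prop
    extends IsGradedHom P.toGradedDoctrine Q.toGradedDoctrine F where
  dist (A : P.base) :
    Q.re (prodComparison F.fn A A) (Q.dist (F.fn.obj A)) = F.on (P.dist A)

/-- An elementary `R`-graded doctrine. -/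
structure ElementaryDoctrine (R : Type x) [ResourceSemiring R] extends
    GradedDoctrine.{w, v, u} R where
  elementary : toLinearDoctrine.IsElementary

namespace ElementaryDoctrine

/-- The equality predicate on `A` (it is unique). -/
noncomputable def eqPred (P : ElementaryDoctrine.{w, v, u} R) (A : P.base) : P.Fib (A ⊗ A) :=
  (P.elementary A).choose

theorem isEqPred (P : ElementaryDoctrine.{w, v, u} R) (A : P.base) :
    P.IsEqPred (P.eqPred A) :=
  (P.elementary A).choose_spec

/-- The left adjoint to reindexing along `id_X × Δ_A`. -/
noncomputable def exDiag (P : ElementaryDoctrine.{w, v, u} R) (X A : P.base)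
    (α : P.Fib (X ⊗ A)) : P.Fib (X ⊗ (A ⊗ A)) :=
  P.tens (P.re (p₁₂ X A A) α) (P.re (p₂₃ X A A) (P.eqPred A))

theorem exDiag_gc (P : ElementaryDoctrine.{w, v, u} R) (X A : P.base) :
    GaloisConnection (P.exDiag X A) (P.re (X ◁ diag A)) := by
  intro α β
  constructor
  · intro h
    have h₁ := P.re_mono (X ◁ diag A) h
    rw [exDiag, P.re_tens, P.re_re, P.re_re] at h₁
    have h₂ := P.re_mono (snd X A) (P.isEqPred A).refl
    rw [P.re_one, P.re_re] at h₂
    have h₃ := P.tens_mono h₂ (le_refl α)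
    rw [P.one_tens, P.tens_comm] at h₃
    refine h₃.trans (le_trans (le_of_eq ?_) h₁)
    congr 1
    · rw [← P.re_id α, P.re_re]
      congr 1
      ext <;> simp [p₁₂, diag]
    · congr 1
      simp [p₂₃]
  · intro h
    have h₁ := P.re_mono (p₁₂ X A A) h
    have h₂ := (P.isEqPred A).subst_at (p₁₂ X A A) (snd X (A ⊗ A) ≫ fst A A)
      (snd X (A ⊗ A) ≫ snd A A) (P.re (α_ X A A).hom β)
    rw [P.re_re] at h₁ h₂
    refine le_trans (le_trans (P.tens_mono h₁ le_rfl) (le_of_eq ?_)) (h₂.trans (le_of_eq ?_))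
    · congr 1
      · congr 1
        ext <;> simp [p₁₂, diag]
      · congr 1
        ext <;> simp [p₂₃]
    · rw [P.re_re]
      conv_rhs => rw [← P.re_id β]
      congr 1
      ext <;> simp [p₁₂]

theorem eqPred_intuitionistic (P : ElementaryDoctrine.{w, v, u} R) (A : P.base) :
    P.IsIntuitionistic (P.eqPred A) := fun r =>
  (P.isEqPred A).le_of_refl (by
    rw [P.re_mod]
    exact (P.one_le_mod r A).trans (P.mod_mono r (P.isEqPred A).refl))

/-- An elementary graded doctrine is Lipschitz, with the equality predicates as distances. -/
noncomputable def toLipschitz (P : ElementaryDoctrine.{w, v, u} R) :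
    LipschitzDoctrine.{w, v, u} R where
  toGradedDoctrine := P.toGradedDoctrine
  dist := P.eqPred
  isDistance A := (P.isEqPred A).isDistance
  subst A X α := ⟨1, (P.tens_mono le_rfl (P.counit _)).trans ((P.isEqPred A).subst X α)⟩
  dist_prod A X := (P.isEqPred A).prod (P.isEqPred X) (P.isEqPred (A ⊗ X))
  dist_prod_le_left A X := by
    rw [(P.isEqPred A).prod (P.isEqPred X) (P.isEqPred (A ⊗ X))]
    apply LinearDoctrine.IsEqPred.tens_le_left
    rw [← P.re_one (q₂₄ A X)]
    exact P.re_mono _ (P.isEqPred X).affine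
  dist_prod_le_right A X := by
    rw [(P.isEqPred A).prod (P.isEqPred X) (P.isEqPred (A ⊗ X)), P.tens_comm]
    apply LinearDoctrine.IsEqPred.tens_le_left
    rw [← P.re_one (q₁₃ A X)]
    exact P.re_mono _ (P.isEqPred A).affine
  dist_unit := (P.isEqPred _).unit_eq

end ElementaryDoctrine

/-- 1-arrows of elementary graded doctrines: 1-arrows of graded doctrines that commute with the
left adjoints to the reindexings along `id_X × Δ_A`, up to the canonical isomorphisms
`F (X × A) ≅ F X × F A` and `F (X × A × A) ≅ F X × F A × F A`. -/
structure IsElementaryHom (P Q : ElementaryDoctrine.{w, v, u} R)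
    (F : P.toDoctrine ⟶ Q.toDoctrine) : Prop
    extends IsGradedHom P.toGradedDoctrine Q.toGradedDoctrine F where
  exDiag (X A : P.base) (α : P.Fib (X ⊗ A)) :
    Q.re (prodComparison F.fn X (A ⊗ A) ≫ (F.fn.obj X ◁ prodComparison F.fn A A))
        (Q.exDiag (F.fn.obj X) (F.fn.obj A) (Q.re (inv (prodComparison F.fn X A)) (F.on α))) =
      F.on (P.exDiag X A α)

section

variable {P Q S : ElementaryDoctrine.{w, v, u} R} {F : P.toDoctrine ⟶ Q.toDoctrine}

theorem IsElementaryHom.eqPred (h : IsElementaryHom P Q F) (A : P.base) :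
    Q.re (prodComparison F.fn A A) (Q.eqPred (F.fn.obj A)) = F.on (P.eqPred A) := by
  have h₁ := h.exDiag (𝟙_ _) A (P.one _)
  simp only [ElementaryDoctrine.exDiag] at h₁
  rw [h.one, Q.re_one, Q.re_one,
    P.re_one, Q.one_tens, P.one_tens, Q.re_re, F.on_re] at h₁
  have e : (prodComparison F.fn (𝟙_ P.base) (A ⊗ A) ≫
      F.fn.obj (𝟙_ P.base) ◁ prodComparison F.fn A A) ≫
        p₂₃ (F.fn.obj (𝟙_ P.base)) (F.fn.obj A) (F.fn.obj A) =
      F.fn.map (p₂₃ (𝟙_ P.base) A A) ≫ prodComparison F.fn A A := by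
    simp [p₂₃]
  rw [e, ← Q.re_re] at h₁
  have e' : lift (toUnit (A ⊗ A)) (𝟙 (A ⊗ A)) ≫ p₂₃ (𝟙_ P.base) A A = 𝟙 _ := by
    simp [p₂₃]
  have inj (β : Q.Fib (F.fn.obj (A ⊗ A))) :
      Q.re (F.fn.map (lift (toUnit (A ⊗ A)) (𝟙 (A ⊗ A))))
        (Q.re (F.fn.map (p₂₃ (𝟙_ P.base) A A)) β) = β := by
    rw [Q.re_re, ← F.fn.map_comp, e', F.fn.map_id, Q.re_id]
  rw [← inj (Q.re _ _), h₁, inj]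

theorem IsElementaryHom.of_eqPred (h : IsGradedHom P.toGradedDoctrine Q.toGradedDoctrine F)
    (hd : ∀ A : P.base,
      Q.re (prodComparison F.fn A A) (Q.eqPred (F.fn.obj A)) = F.on (P.eqPred A)) :
    IsElementaryHom P Q F where
  toIsGradedHom := h
  exDiag X A α := by
    simp only [ElementaryDoctrine.exDiag]
    rw [h.tens, Q.re_tens, Q.re_re, Q.re_re, Q.re_re, F.on_re, F.on_re, ← hd, Q.re_re]
    congr 1
    · congr 1
      rw [IsIso.comp_inv_eq]
      ext <;> simp [p₁₂, ← Functor.map_comp]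
    · congr 1
      simp [p₂₃]

theorem IsElementaryHom.isLipschitzHom (h : IsElementaryHom P Q F) :
    IsLipschitzHom P.toLipschitz Q.toLipschitz F where
  toIsGradedHom := h.toIsGradedHom
  dist A := h.eqPred A

theorem IsLipschitzHom.isElementaryHom (h : IsLipschitzHom P.toLipschitz Q.toLipschitz F) :
    IsElementaryHom P Q F :=
  IsElementaryHom.of_eqPred h.toIsGradedHom h.dist

end

theorem IsLipschitzHom.id (P : LipschitzDoctrine.{w, v, u} R) :
    IsLipschitzHom P P (𝟙 P.toDoctrine) where
  toIsGradedHom := IsGradedHom.id P.toGradedDoctrine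
  dist A := by
    have e : prodComparison (Doctrine.Hom.fn (𝟙 P.toDoctrine)) A A = 𝟙 (A ⊗ A) := by
      ext <;> simp
    rw [e]
    exact P.re_id _

theorem IsLipschitzHom.comp {P Q S : LipschitzDoctrine.{w, v, u} R}
    {F : P.toDoctrine ⟶ Q.toDoctrine} {G : Q.toDoctrine ⟶ S.toDoctrine}
    (hF : IsLipschitzHom P Q F) (hG : IsLipschitzHom Q S G) : IsLipschitzHom P S (F ≫ G) where
  toIsGradedHom := hF.toIsGradedHom.comp hG.toIsGradedHom
  dist A := by
    have e : prodComparison (Doctrine.Hom.fn (F ≫ G)) A A =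
        G.fn.map (prodComparison F.fn A A) ≫
          prodComparison G.fn (F.fn.obj A) (F.fn.obj A) :=
      prodComparison_comp ..
    rw [e, Doctrine.comp_on, ← hF.dist, G.on_re, ← hG.dist, ← S.re_re]
    rfl

/-- The 1-arrows between `R`-Lipschitz doctrines. -/
def lipCells (R : Type x) [ResourceSemiring R] :
    OneCells (LipschitzDoctrine.{w, v, u} R) Doctrine.{w, v, u} where
  obj P := P.toDoctrine
  P := IsLipschitzHom
  id_mem := IsLipschitzHom.id
  comp_mem _ _ hF hG := IsLipschitzHom.comp hF hG

/-- The 2-category of `R`-Lipschitz doctrines, the 1-arrows of doctrines that preserve the graded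
structure and the distances, and all 2-arrows of doctrines between them. -/
abbrev LipDoc (R : Type x) [ResourceSemiring R] := LocallyFull (lipCells.{w, v, u} R)

/-- The 1-arrows between elementary `R`-graded doctrines. -/
def elCells (R : Type x) [ResourceSemiring R] :
    OneCells (ElementaryDoctrine.{w, v, u} R) Doctrine.{w, v, u} where
  obj P := P.toDoctrine
  P := IsElementaryHom
  id_mem P := (IsLipschitzHom.id P.toLipschitz).isElementaryHom
  comp_mem _ _ hF hG := (IsLipschitzHom.comp (IsElementaryHom.isLipschitzHom hF)
    (IsElementaryHom.isLipschitzHom hG)).isElementaryHom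

/-- The 2-category of elementary `R`-graded doctrines, the 1-arrows of doctrines that preserve the
graded structure and the left adjoints giving equality, and all 2-arrows of doctrines between
them. -/
abbrev ElDoc (R : Type x) [ResourceSemiring R] := LocallyFull (elCells.{w, v, u} R)

/-- The inclusion 2-functor of elementary graded doctrines into Lipschitz doctrines. -/
noncomputable def elToLip (R : Type x) [ResourceSemiring R] :
    StrictPseudofunctor (ElDoc.{w, v, u} R) (LipDoc.{w, v, u} R) :=
  StrictPseudofunctor.mk''
    { obj := fun P => ⟨P.as.toLipschitz⟩
      map := fun {P Q} f => LocallyFull.Hom.mk (W := lipCells R) (X := ⟨P.as.toLipschitz⟩)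
        (Y := ⟨Q.as.toLipschitz⟩) (LocallyFull.Hom.hom (W := elCells R) f)
        (IsElementaryHom.isLipschitzHom (LocallyFull.Hom.mem (W := elCells R) f))
      map₂ := fun a => LocallyFull.Hom₂.mk (LocallyFull.Hom₂.hom (W := elCells R) a)
      map₂_id := fun _ => rfl
      map₂_comp := fun _ _ => rfl
      map_id := fun _ => rfl
      map_comp := fun _ _ => rfl
      map₂_whisker_left := fun _ _ _ _ => by
        symm
        exact (Category.id_comp _).trans (Category.comp_id _)
      map₂_whisker_right := fun _ _ => by
        symm
        exact (Category.id_comp _).trans (Category.comp_id _) }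

section Restriction

variable {C : Type u} [Category.{v} C] [CartesianMonoidalCategory C]

/-- A full subcategory that contains the chosen terminal object and is closed under the chosen
binary products inherits these finite products. -/
@[reducible]
def subCartesian (S : ObjectProperty C) (h₀ : S (𝟙_ C)) (h₂ : ∀ X Y, S X → S Y → S (X ⊗ Y)) :
    CartesianMonoidalCategory S.FullSubcategory where
  __ := MonoidalCategory.fullSubcategory S h₀ h₂
  isTerminalTensorUnit := .ofUniqueHom (fun X ↦ ObjectProperty.homMk (toUnit X.1))
    fun _ _ ↦ by ext; apply toUnit_unique
  fst X Y := ObjectProperty.homMk (fst X.1 Y.1)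
  snd X Y := ObjectProperty.homMk (snd X.1 Y.1)
  tensorProductIsBinaryProduct X Y :=
    Limits.BinaryFan.IsLimit.mk _ (fun f g ↦ ObjectProperty.homMk (lift f.hom g.hom))
      (by intros; ext; simp) (by intros; ext; simp)
      (by intro T f g m h₁ h₂; ext; apply hom_ext <;> simp [← h₁, ← h₂])
  fst_def X Y := by ext; exact fst_def X.1 Y.1
  snd_def X Y := by ext; exact snd_def X.1 Y.1

end Restriction

/-- The restriction of a graded doctrine to a full subcategory of its base that is closed under
finite products. -/
def GradedDoctrine.restrict (P : GradedDoctrine.{w, v, u} R) (S : ObjectProperty P.base)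
    (h₀ : S (𝟙_ P.base)) (h₂ : ∀ X Y, S X → S Y → S (X ⊗ Y)) : GradedDoctrine.{w, v, u} R where
  base := S.FullSubcategory
  cart := subCartesian S h₀ h₂
  fib := S.ι.op ⋙ P.fib
  tens {X} α β := P.tens (X := X.obj) α β
  one X := P.one X.obj
  tens_mono h h' := P.tens_mono h h'
  tens_assoc := P.tens_assoc
  tens_comm := P.tens_comm
  one_tens := P.one_tens
  re_tens f := P.re_tens f.hom
  re_one f := P.re_one f.hom
  mod r X α := P.mod r (X := X.obj) α
  mod_mono r _ _ _ h := P.mod_mono r h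
  re_mod r _ _ f := P.re_mod r f.hom
  one_le_mod r X := P.one_le_mod r X.obj
  mod_tens_le r _ := P.mod_tens_le r
  weakening := P.weakening
  contraction r s _ := P.contraction r s
  counit := P.counit
  comult r s _ := P.comult r s
  contravariance := P.contravariance

namespace LipschitzDoctrine

/-- The objects of the base whose distance is intuitionistic. -/
def intObj (P : LipschitzDoctrine.{w, v, u} R) : ObjectProperty P.base :=
  fun A => P.IsIntuitionistic (P.dist A)

theorem intObj_unit (P : LipschitzDoctrine.{w, v, u} R) : P.intObj (𝟙_ P.base) := fun r => by
  rw [P.dist_unit]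
  exact P.one_le_mod r _

theorem intObj_prod (P : LipschitzDoctrine.{w, v, u} R) (A B : P.base) (hA : P.intObj A)
    (hB : P.intObj B) : P.intObj (A ⊗ B) := fun r => by
  rw [P.dist_prod]
  refine le_trans (P.tens_mono ?_ ?_) (P.mod_tens_le r _ _)
  · rw [← P.re_mod]
    exact P.re_mono _ (hA r)
  · rw [← P.re_mod]
    exact P.re_mono _ (hB r)

/-- The restriction of a Lipschitz doctrine to the objects whose distance is intuitionistic, as a
graded doctrine. -/
def intGraded (P : LipschitzDoctrine.{w, v, u} R) : GradedDoctrine.{w, v, u} R :=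
  P.restrict P.intObj P.intObj_unit P.intObj_prod

theorem intGraded_isEqPred (P : LipschitzDoctrine.{w, v, u} R) (A : P.intGraded.base) :
    P.intGraded.IsEqPred (A := A) (P.dist A.obj) where
  refl := (P.isDistance A.obj).refl
  subst X α := by
    obtain ⟨r, hr⟩ := P.subst A.obj X.obj α
    refine le_trans (P.tens_mono le_rfl ?_) hr
    rw [← P.re_mod]
    exact P.re_mono _ (A.property r)

/-- The restriction of a Lipschitz doctrine to the objects whose distance is intuitionistic is an
elementary graded doctrine. -/
def intPart (P : LipschitzDoctrine.{w, v, u} R) : ElementaryDoctrine.{w, v, u} R where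
  toGradedDoctrine := P.intGraded
  elementary A := ⟨P.dist A.obj, P.intGraded_isEqPred A⟩

theorem intPart_eqPred (P : LipschitzDoctrine.{w, v, u} R) (A : P.intPart.base) :
    P.intPart.eqPred A = P.dist A.obj :=
  (P.intPart.isEqPred A).unique (P.intGraded_isEqPred A)

end LipschitzDoctrine

theorem preservesFiniteProducts_ι {C : Type u} [Category.{v} C] [CartesianMonoidalCategory C]
    (S : ObjectProperty C) (h₀ : S (𝟙_ C)) (h₂ : ∀ X Y, S X → S Y → S (X ⊗ Y)) :
    PreservesFiniteProducts S.ι := by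
  let := subCartesian S h₀ h₂
  have h₁ (A B : S.FullSubcategory) : IsIso (prodComparison S.ι A B) := by
    have e : prodComparison S.ι A B = 𝟙 (A.obj ⊗ B.obj) := by
      apply hom_ext
      · exact (prodComparison_fst S.ι A B).trans (Category.id_comp _).symm
      · exact (prodComparison_snd S.ι A B).trans (Category.id_comp _).symm
    rw [e]
    exact IsIso.id _
  have h₃ : IsIso (terminalComparison S.ι) := by
    have e : terminalComparison S.ι = 𝟙 (𝟙_ C) := toUnit_unique _ _
    rw [e]
    exact IsIso.id _
  have := preservesLimitsOfShape_discrete_walkingPair_of_isIso_prodComparison S.ι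
  have := preservesLimit_empty_of_isIso_terminalComparison S.ι
  have := Limits.preservesLimitsOfShape_pempty_of_preservesTerminal S.ι
  exact .of_preserves_binary_and_terminal _

theorem preservesFiniteProducts_lift {C : Type u} [Category.{v} C] [CartesianMonoidalCategory C]
    {D : Type u₁} [Category.{v₁} D] (S : ObjectProperty C) (T : ObjectProperty D) (h₀ : S (𝟙_ C))
    (h₂ : ∀ X Y, S X → S Y → S (X ⊗ Y)) (F : C ⥤ D) [PreservesFiniteProducts F]
    (h : ∀ A : S.FullSubcategory, T ((S.ι ⋙ F).obj A)) :
    PreservesFiniteProducts (T.lift (S.ι ⋙ F) h) := by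
  have h₁ : PreservesFiniteProducts S.ι := preservesFiniteProducts_ι S h₀ h₂
  have h₃ : PreservesFiniteProducts (T.lift (S.ι ⋙ F) h ⋙ T.ι) :=
    inferInstanceAs (PreservesFiniteProducts (S.ι ⋙ F))
  exact ⟨fun n => Limits.preservesLimitsOfShape_of_reflects_of_preserves _ T.ι⟩

/-- The inclusion of the restriction of a Lipschitz doctrine to the objects with intuitionistic
distance into the doctrine itself. -/
def LipschitzDoctrine.incl (P : LipschitzDoctrine.{w, v, u} R) :
    P.intPart.toDoctrine ⟶ P.toDoctrine :=
  Doctrine.Hom.mk P.intObj.ι (preservesFiniteProducts_ι _ P.intObj_unit P.intObj_prod)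
    (𝟙 (P.intObj.ι.op ⋙ P.fib))

theorem LipschitzDoctrine.incl_mem (P : LipschitzDoctrine.{w, v, u} R) :
    IsLipschitzHom P.intPart.toLipschitz P P.incl where
  tens _ _ := rfl
  one _ := rfl
  mod _ _ _ := rfl
  dist A := by
    have e : prodComparison P.incl.fn A A = 𝟙 (A.obj ⊗ A.obj) := by
      apply hom_ext
      · exact (prodComparison_fst P.incl.fn A A).trans (Category.id_comp _).symm
      · exact (prodComparison_snd P.incl.fn A A).trans (Category.id_comp _).symm
    have h : P.intPart.toLipschitz.dist A = P.dist A.obj := P.intPart_eqPred A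
    rw [h]
    exact (congrArg (fun k => P.re k (P.dist A.obj)) e).trans (P.re_id _)

section

variable {P Q : LipschitzDoctrine.{w, v, u} R} {F : P.toDoctrine ⟶ Q.toDoctrine}

theorem IsLipschitzHom.intObj (h : IsLipschitzHom P Q F) {A : P.base} (hA : P.intObj A) :
    Q.intObj (F.fn.obj A) := fun r => by
  have h₁ := F.on_mono (hA r)
  rw [h.mod, ← h.dist, ← Q.re_mod] at h₁
  have h₂ := Q.re_mono (inv (prodComparison F.fn A A)) h₁
  rwa [Q.re_re, Q.re_re, IsIso.inv_hom_id, Q.re_id, Q.re_id] at h₂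

/-- The restriction of a 1-arrow of Lipschitz doctrines to the objects with intuitionistic
distance. -/
def IsLipschitzHom.restrict (h : IsLipschitzHom P Q F) :
    P.intPart.toDoctrine ⟶ Q.intPart.toDoctrine :=
  Doctrine.Hom.mk (Q.intObj.lift (P.intObj.ι ⋙ F.fn) (fun A => h.intObj A.property))
    (preservesFiniteProducts_lift P.intObj Q.intObj P.intObj_unit P.intObj_prod F.fn
      (fun A => h.intObj A.property))
    { app := fun X => F.nt.app (op X.unop.obj)
      naturality := fun _ _ f => F.nt.naturality f.unop.hom.op }

theorem IsLipschitzHom.restrict_mem (h : IsLipschitzHom P Q F) :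
    IsElementaryHom P.intPart Q.intPart h.restrict :=
  IsElementaryHom.of_eqPred
    { tens := fun α β => h.tens α β
      one := fun X => h.one X.obj
      mod := fun r _ α => h.mod r α }
    (fun A => by
      rw [LipschitzDoctrine.intPart_eqPred, LipschitzDoctrine.intPart_eqPred]
      have e : (prodComparison h.restrict.fn A A).hom = prodComparison F.fn A.obj A.obj := by
        apply hom_ext
        · exact (congrArg InducedCategory.Hom.hom (prodComparison_fst h.restrict.fn A A)).trans
            (prodComparison_fst F.fn A.obj A.obj).symm
        · exact (congrArg InducedCategory.Hom.hom (prodComparison_snd h.restrict.fn A A)).trans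
            (prodComparison_snd F.fn A.obj A.obj).symm
      refine Eq.trans ?_ (h.dist A.obj)
      rw [← e]
      rfl)

end

/-- The 2-functor sending a Lipschitz doctrine to its restriction to the objects whose distance is
intuitionistic, and restricting 1-arrows and 2-arrows accordingly. -/
def lipToEl (R : Type x) [ResourceSemiring R] :
    StrictPseudofunctor (LipDoc.{w, v, u} R) (ElDoc.{w, v, u} R) :=
  StrictPseudofunctor.mk''
    { obj := fun P => ⟨P.as.intPart⟩
      map := fun {P Q} f => LocallyFull.Hom.mk (W := elCells R) (X := ⟨P.as.intPart⟩)
        (Y := ⟨Q.as.intPart⟩) (LocallyFull.Hom.mem (W := lipCells R) f).restrict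
        (LocallyFull.Hom.mem (W := lipCells R) f).restrict_mem
      map₂ := fun {P Q f g} a => LocallyFull.Hom₂.mk
        (Doctrine.Hom₂.mk
          { app := fun X => ObjectProperty.homMk
              ((Doctrine.Hom₂.nat (LocallyFull.Hom₂.hom (W := lipCells R) a)).app X.obj)
            naturality := fun X Y k => ObjectProperty.hom_ext _
              ((Doctrine.Hom₂.nat (LocallyFull.Hom₂.hom (W := lipCells R) a)).naturality k.hom) }
          (fun X α => Doctrine.Hom₂.le (LocallyFull.Hom₂.hom (W := lipCells R) a) X.obj α))
      map₂_id := fun _ => rfl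
      map₂_comp := fun _ _ => rfl
      map_id := fun _ => rfl
      map_comp := fun _ _ => rfl
      map₂_whisker_left := fun _ _ _ _ => by
        symm
        exact (Category.id_comp _).trans (Category.comp_id _)
      map₂_whisker_right := fun _ _ => by
        symm
        exact (Category.id_comp _).trans (Category.comp_id _) }

/-- The inclusion `LipschitzDoctrine.incl`, as a 1-arrow of Lipschitz doctrines. -/
noncomputable def inclusion {R : Type x} [ResourceSemiring R] (P : LipDoc.{w, v, u} R) :
    (elToLip R).obj ((lipToEl R).obj P) ⟶ P :=
  LocallyFull.Hom.mk (W := lipCells R) (X := ⟨P.as.intPart.toLipschitz⟩) P.as.incl P.as.incl_mem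

end Doctrines

/-!
A 1-arrow into the restriction of a doctrine to a full subcategory is determined by its composite
with the inclusion, so every component of the counit is a monomorphism. The structure 1-arrow of a
coalgebra is a section of a counit component, hence inverse to it. Being a coalgebra is therefore a
property of the underlying doctrine: the inclusion has a section exactly when every distance is
intuitionistic, and then the distances are equality predicates because the scalar in the
substitution law of a Lipschitz doctrine can be absorbed.
-/

namespace TwoCat

open CategoryTheory Bicategory

/-- A section of a monomorphism `m` is inverse to `m`. -/
def isoOfMonoRetraction {C : Type u} [Category.{v} C] {X Y : C} (s : X ⟶ Y) (m : Y ⟶ X) [Mono m]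
    (h : s ≫ m = 𝟙 X) : X ≅ Y where
  hom := s
  inv := m
  hom_inv_id := h
  inv_hom_id := by rw [← cancel_mono m, Category.assoc, h, Category.comp_id, Category.id_comp]

section

variable {C : Type u} [Bicategory.{w, v} C] [Bicategory.Strict C]

/-- The adjunction carried by an isomorphism of a strict 2-category; its unit and counit are
identity 2-cells. -/
def adjunctionOfIso {X Y : C} (e : X ≅ Y) : Bicategory.Adjunction e.hom e.inv where
  unit := eqToHom e.hom_inv_id.symm
  counit := eqToHom e.inv_hom_id
  left_triangle := by
    simp [leftZigzag, bicategoricalComp, Strict.associator_eqToIso, Strict.leftUnitor_eqToIso,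
      Strict.rightUnitor_eqToIso]
  right_triangle := by
    simp [rightZigzag, bicategoricalComp, Strict.associator_eqToIso, Strict.leftUnitor_eqToIso,
      Strict.rightUnitor_eqToIso]

/-- The component of the counit at `X`, with its target written `X` rather than
`(StrictPseudofunctor.id C).obj X`. -/
abbrev TwoComonad.counitAt (T : TwoComonad C) (X : C) : T.fn.obj X ⟶ X := T.counit.app X

variable {T : TwoComonad C}

theorem Coalgebra.obj_injective [∀ X : C, Mono (T.counitAt X)] :
    Function.Injective (obj : Coalgebra T → C) := by
  rintro ⟨X, a, ha, _⟩ ⟨Y, b, hb, _⟩ h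
  obtain rfl : X = Y := h
  obtain rfl : a = b := (cancel_mono (T.counitAt X)).1 (ha.trans hb.symm)
  rfl

theorem TwoComonad.isKZ_of_mono_counit [∀ X : C, Mono (T.counitAt X)] :
    T.IsKZ :=
  fun A => ⟨adjunctionOfIso (isoOfMonoRetraction A.str (T.counitAt A.obj) A.counit), rfl⟩

end

section

variable {B : Type u₁} [Bicategory.{w₁, v₁} B] [Bicategory.Strict B]
  {C : Type u₂} [Bicategory.{w₂, v₂} C] [Bicategory.Strict C]
  {F : StrictPseudofunctor B C} {G : StrictPseudofunctor C B}

namespace TwoAdjunction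

/-- The component of the counit at `Y`, with its target written `Y` rather than
`(StrictPseudofunctor.id C).obj Y`. -/
abbrev counitAt (adj : TwoAdjunction F G) (Y : C) : F.obj (G.obj Y) ⟶ Y := adj.counit.app Y

instance comonad_counitAt_mono (adj : TwoAdjunction F G) (Y : C) [h : Mono (adj.counitAt Y)] :
    Mono (adj.comonad.counitAt Y) :=
  h

theorem comparison_isTwoIso (adj : TwoAdjunction F G)
    [∀ Y : C, Mono (adj.counitAt Y)]
    (obj_inj : Function.Injective F.obj)
    (map_bij : ∀ X Y : B, Function.Bijective (fun f : X ⟶ Y => F.map f))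
    (map₂_bij : ∀ {X Y : B} (f g : X ⟶ Y), Function.Bijective (fun η : f ⟶ g => F.map₂ η))
    (mem_range : ∀ (Y : C) (c : Y ⟶ F.obj (G.obj Y)),
      c ≫ adj.counitAt Y = 𝟙 Y → Y ∈ Set.range F.obj) :
    IsTwoIso adj.comparison where
  obj := by
    refine ⟨fun X Y h => obj_inj (congrArg Coalgebra.obj h), fun A => ?_⟩
    obtain ⟨X, hX⟩ := mem_range A.obj A.str A.counit
    exact ⟨X, Coalgebra.obj_injective hX⟩
  map X Y := by
    refine ⟨fun f g h => (map_bij X Y).injective (congrArg Coalgebra.Hom.hom h), fun k => ?_⟩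
    obtain ⟨f, hf⟩ := (map_bij X Y).surjective (Coalgebra.Hom.hom k)
    exact ⟨f, Coalgebra.hom_ext hf⟩
  map₂ f g := by
    refine ⟨fun a b h => (map₂_bij f g).injective (congrArg Coalgebra.Hom₂.hom h), fun k => ?_⟩
    obtain ⟨a, ha⟩ := (map₂_bij f g).surjective (Coalgebra.Hom₂.hom k)
    exact ⟨a, Coalgebra.hom₂_ext ha⟩

end TwoAdjunction

end

theorem LocallyFull.mono_of_mono_hom {B : Type u₁} {C : Type u₂} [Bicategory.{w₂, v₂} C]
    [Bicategory.Strict C] {W : OneCells B C} {X Y : LocallyFull W} (f : X ⟶ Y)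
    [Mono (Hom.hom f)] : Mono f where
  right_cancellation _ _ h := hom_ext ((cancel_mono (Hom.hom f)).1 (congrArg Hom.hom h))

end TwoCat

namespace Doctrines

open CategoryTheory Bicategory MonoidalCategory CartesianMonoidalCategory Opposite TwoCat
open Limits (PreservesLimitsOfShape)

variable {R : Type x} [ResourceSemiring R]

theorem preservesLimitsOfShape_lift {J : Type u₂} [Category.{v₂} J] {C : Type u} [Category.{v} C]
    {D : Type u₁} [Category.{v₁} D] (S : ObjectProperty D) (F : C ⥤ D)
    [PreservesLimitsOfShape J F] (h : ∀ A, S (F.obj A)) :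
    PreservesLimitsOfShape J (S.lift F h) := by
  have : PreservesLimitsOfShape J (S.lift F h ⋙ S.ι) :=
    inferInstanceAs (PreservesLimitsOfShape J F)
  exact Limits.preservesLimitsOfShape_of_reflects_of_preserves _ S.ι

namespace GradedDoctrine

variable (P : GradedDoctrine.{w, v, u} R) {S : ObjectProperty P.base} (h₀ : S (𝟙_ P.base))
  (h₂ : ∀ X Y, S X → S Y → S (X ⊗ Y))

/-- The inclusion of the restriction of a graded doctrine to a full subcategory of its base. -/
def restrictIncl : (P.restrict S h₀ h₂).toDoctrine ⟶ P.toDoctrine :=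
  Doctrine.Hom.mk S.ι (preservesFiniteProducts_ι S h₀ h₂) (𝟙 (S.ι.op ⋙ P.fib))

/-- The factorization through the restriction of `P` to `S` of a 1-arrow whose values on objects
lie in `S`. -/
def corestrict {E : Doctrine.{w, v, u}} (F : E ⟶ P.toDoctrine) (hF : ∀ A, S (F.fn.obj A)) :
    E ⟶ (P.restrict S h₀ h₂).toDoctrine :=
  Doctrine.Hom.mk (S.lift F.fn hF) ⟨fun _ => preservesLimitsOfShape_lift S F.fn hF⟩
    { app := fun X => F.nt.app X
      naturality := fun _ _ f => F.nt.naturality f }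

theorem corestrict_of_comp_restrictIncl {E : Doctrine.{w, v, u}}
    (F : E ⟶ (P.restrict S h₀ h₂).toDoctrine) :
    P.corestrict h₀ h₂ (F ≫ P.restrictIncl h₀ h₂) (fun A => (F.fn.obj A).property) = F :=
  rfl

instance restrictIncl_mono : Mono (P.restrictIncl h₀ h₂) where
  right_cancellation F G h := by
    rw [← P.corestrict_of_comp_restrictIncl h₀ h₂ F, ← P.corestrict_of_comp_restrictIncl h₀ h₂ G]
    congr 1

theorem mem_of_restrictIncl_section {c : P.toDoctrine ⟶ (P.restrict S h₀ h₂).toDoctrine}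
    (hc : c ≫ P.restrictIncl h₀ h₂ = 𝟙 P.toDoctrine) (A : P.base) : S A := by
  have hA : (c.fn.obj A).obj = A := congrArg (fun F => (Doctrine.Hom.fn F).obj A) hc
  exact hA ▸ (c.fn.obj A).property

theorem prodComparison_corestrict_hom {E : Doctrine.{w, v, u}} (F : E ⟶ P.toDoctrine)
    (hF : ∀ A, S (F.fn.obj A)) (A B : E.base) :
    (prodComparison (P.corestrict h₀ h₂ F hF).fn A B).hom = prodComparison F.fn A B := by
  let G := (P.corestrict h₀ h₂ F hF).fn
  apply hom_ext
  · exact (congrArg InducedCategory.Hom.hom (prodComparison_fst G A B)).trans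
      (prodComparison_fst F.fn A B).symm
  · exact (congrArg InducedCategory.Hom.hom (prodComparison_snd G A B)).trans
      (prodComparison_snd F.fn A B).symm

end GradedDoctrine

theorem IsGradedHom.corestrict {P Q : GradedDoctrine.{w, v, u} R}
    {F : P.toDoctrine ⟶ Q.toDoctrine} (h : IsGradedHom P Q F) {S : ObjectProperty Q.base}
    (h₀ : S (𝟙_ Q.base)) (h₂ : ∀ X Y, S X → S Y → S (X ⊗ Y)) (hF : ∀ A, S (F.fn.obj A)) :
    IsGradedHom P (Q.restrict S h₀ h₂) (Q.corestrict h₀ h₂ F hF) where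
  tens α β := h.tens α β
  one X := h.one X
  mod r _ α := h.mod r α

namespace LipschitzDoctrine

/-- The factorization of a 1-arrow whose values on objects have intuitionistic distance through
`LipschitzDoctrine.incl`. -/
def corestrict (Q : LipschitzDoctrine.{w, v, u} R) {E : Doctrine.{w, v, u}}
    (F : E ⟶ Q.toDoctrine) (hF : ∀ A, Q.intObj (F.fn.obj A)) : E ⟶ Q.intPart.toDoctrine :=
  Q.toGradedDoctrine.corestrict Q.intObj_unit Q.intObj_prod F hF

end LipschitzDoctrine

theorem IsLipschitzHom.corestrict {P Q : LipschitzDoctrine.{w, v, u} R}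
    {F : P.toDoctrine ⟶ Q.toDoctrine} (h : IsLipschitzHom P Q F)
    (hF : ∀ A, Q.intObj (F.fn.obj A)) :
    IsLipschitzHom P Q.intPart.toLipschitz (Q.corestrict F hF) where
  toIsGradedHom := h.toIsGradedHom.corestrict Q.intObj_unit Q.intObj_prod hF
  dist A := by
    have dist_eq : Q.intPart.toLipschitz.dist ((Q.corestrict F hF).fn.obj A) =
        Q.dist (F.fn.obj A) := Q.intPart_eqPred _
    have comparison_eq : (prodComparison (Q.corestrict F hF).fn A A).hom =
        prodComparison F.fn A A := Q.prodComparison_corestrict_hom _ _ F hF A A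
    rw [dist_eq]
    exact (congrArg (fun k => Q.re k (Q.dist (F.fn.obj A))) comparison_eq).trans (h.dist A)

namespace LipschitzDoctrine

variable (P : LipschitzDoctrine.{w, v, u} R)

theorem isEqPred_dist {A : P.base} (hA : P.intObj A) : P.IsEqPred (P.dist A) where
  refl := (P.isDistance A).refl
  subst X α := by
    obtain ⟨r, hr⟩ := P.subst A X α
    have dist_le_mod : P.re (p₂₃ X A A) (P.dist A) ≤ P.mod r (P.re (p₂₃ X A A) (P.dist A)) := by
      rw [← P.re_mod]
      exact P.re_mono _ (hA r)
    exact (P.tens_mono le_rfl dist_le_mod).trans hr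

/-- A Lipschitz doctrine all of whose distances are intuitionistic, as an elementary doctrine. -/
def toElementary (h : ∀ A, P.intObj A) : ElementaryDoctrine.{w, v, u} R where
  toGradedDoctrine := P.toGradedDoctrine
  elementary A := ⟨P.dist A, P.isEqPred_dist (h A)⟩

theorem toElementary_toLipschitz (h : ∀ A, P.intObj A) : (P.toElementary h).toLipschitz = P := by
  have eqPred_eq : (P.toElementary h).eqPred = P.dist := funext fun A =>
    ((P.toElementary h).isEqPred A).unique (P.isEqPred_dist (h A))
  obtain ⟨G, d, _⟩ := P
  simp only [ElementaryDoctrine.toLipschitz, LipschitzDoctrine.mk.injEq]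
  exact ⟨rfl, heq_of_eq eqPred_eq⟩

end LipschitzDoctrine

theorem ElementaryDoctrine.toLipschitz_injective :
    Function.Injective (toLipschitz : ElementaryDoctrine.{w, v, u} R → _) := by
  rintro ⟨P, _⟩ ⟨Q, _⟩ h
  obtain rfl : P = Q := congrArg LipschitzDoctrine.toGradedDoctrine h
  rfl

theorem elToLip_obj_injective : Function.Injective (elToLip.{w, v, u} R).obj := by
  rintro ⟨P⟩ ⟨Q⟩ h
  exact congrArg LocallyFull.mk
    (ElementaryDoctrine.toLipschitz_injective (congrArg LocallyFull.as h))

theorem elToLip_map_bijective (P Q : ElDoc.{w, v, u} R) :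
    Function.Bijective (fun f : P ⟶ Q => (elToLip R).map f) :=
  ⟨fun f g (h : (elToLip R).map f = (elToLip R).map g) =>
      LocallyFull.hom_ext (congrArg (LocallyFull.Hom.hom (W := lipCells R)) h),
    fun k => ⟨LocallyFull.Hom.mk (W := elCells R) (LocallyFull.Hom.hom (W := lipCells R) k)
      (IsLipschitzHom.isElementaryHom (LocallyFull.Hom.mem (W := lipCells R) k)), rfl⟩⟩

theorem elToLip_map₂_bijective {P Q : ElDoc.{w, v, u} R} (f g : P ⟶ Q) :
    Function.Bijective (fun η : f ⟶ g => (elToLip R).map₂ η) :=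
  ⟨fun a b (h : (elToLip R).map₂ a = (elToLip R).map₂ b) =>
      LocallyFull.hom₂_ext (congrArg (LocallyFull.Hom₂.hom (W := lipCells R)) h),
    fun k => ⟨LocallyFull.Hom₂.mk (W := elCells R)
      (LocallyFull.Hom₂.hom (W := lipCells R) k), rfl⟩⟩

theorem mem_range_elToLip {P : LipDoc.{w, v, u} R} (h : ∀ A, P.as.intObj A) :
    P ∈ Set.range (elToLip R).obj :=
  ⟨⟨P.as.toElementary h⟩, congrArg LocallyFull.mk (P.as.toElementary_toLipschitz h)⟩

instance inclusion_mono (P : LipDoc.{w, v, u} R) : Mono (inclusion P) :=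
  have : Mono (LocallyFull.Hom.hom (inclusion P)) :=
    P.as.restrictIncl_mono P.as.intObj_unit P.as.intObj_prod
  LocallyFull.mono_of_mono_hom _

theorem mem_range_elToLip_of_inclusion_section {P : LipDoc.{w, v, u} R}
    {c : P ⟶ (elToLip R).obj ((lipToEl R).obj P)} (hc : c ≫ inclusion P = 𝟙 P) :
    P ∈ Set.range (elToLip R).obj :=
  mem_range_elToLip (P.as.mem_of_restrictIncl_section P.as.intObj_unit P.as.intObj_prod
    (congrArg LocallyFull.Hom.hom hc))

/-- The unit of the 2-adjunction `elLipAdjunction`: every object of an elementary doctrine has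
intuitionistic distance, so the identity corestricts. -/
noncomputable def toIntPart (P : ElDoc.{w, v, u} R) : P ⟶ (lipToEl R).obj ((elToLip R).obj P) :=
  LocallyFull.Hom.mk (W := elCells R) (X := P) (Y := ⟨P.as.toLipschitz.intPart⟩)
    (P.as.toLipschitz.corestrict (𝟙 P.as.toDoctrine) P.as.eqPred_intuitionistic)
    ((IsLipschitzHom.id P.as.toLipschitz).corestrict
      P.as.eqPred_intuitionistic).isElementaryHom

/-- The 2-adjunction exhibiting elementary doctrines as coreflective in Lipschitz doctrines. -/
noncomputable def elLipAdjunction (R : Type x) [ResourceSemiring R] :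
    TwoAdjunction (elToLip.{w, v, u} R) (lipToEl.{w, v, u} R) where
  unit :=
    { app := toIntPart
      naturality := fun _ => rfl
      naturality₂ := fun _ => (Category.comp_id _).trans (Category.id_comp _).symm }
  counit :=
    { app := inclusion
      naturality := fun _ => rfl
      naturality₂ := fun _ => (Category.comp_id _).trans (Category.id_comp _).symm }
  left_triangle _ := rfl
  right_triangle _ := rfl

instance elLipAdjunction_counitAt_mono (P : LipDoc.{w, v, u} R) :
    Mono ((elLipAdjunction R).counitAt P) :=
  inclusion_mono P

end Doctrines

theorem mainTheorem5 (R : Type x) [Doctrines.ResourceSemiring R] :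
    ∃ adj : TwoCat.TwoAdjunction (Doctrines.elToLip.{w, v, u} R) (Doctrines.lipToEl.{w, v, u} R),
      (∀ P, adj.counit.app P = Doctrines.inclusion P) ∧
      TwoCat.IsTwoIso adj.comparison ∧
      adj.comonad.IsKZ := by
  refine ⟨Doctrines.elLipAdjunction R, fun _ => rfl, ?comparison, ?kz⟩
  case comparison =>
    exact TwoCat.TwoAdjunction.comparison_isTwoIso _ Doctrines.elToLip_obj_injective
      Doctrines.elToLip_map_bijective Doctrines.elToLip_map₂_bijective
      fun _ _ => Doctrines.mem_range_elToLip_of_inclusion_section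
  case kz =>
    exact TwoCat.TwoComonad.isKZ_of_mono_counit
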